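/- Let $\Bbbk$ be a field of characteristic $0$. Let $\mathrm{ICom}$ be the symmetric $2$-coloured operad (first colour: algebra elements; second colour: ideal elements) over $\Bbbk$ presented as follows. Generators: $i$ with one input of the second colour and output of the first colour; $\alpha$ with two inputs and output of the first colour, $\alpha(1,2)=\alpha(2,1)$; and $r$ with inputs of the second and the first colour (in this order) and output of the second colour. Relations (the colours of the inputs are those that make the compositions meaningful): $$\alpha(\alpha(1,2),3)=\alpha(\alpha(1,3),2)=\alpha(1,\alpha(2,3)),\qquad r(r(1,2),3)=r(r(1,3),2)=r(1,\alpha(2,3)),$$ $$\alpha(i(1),2)=i(r(1,2)),\qquad r(1,i(2))=r(2,i(1)).$$ Put $l(1,2):=r(2,1)$. The shuffle operad underlying the free symmetric operad on $i,\alpha,r$ is the free shuffle $2$-coloured operad on $i,\alpha,l,r$; its basis consists of the shuffle trees (planar well-coloured trees with vertices $i,\alpha,l,r$ and labelled leaves such that at every vertex the smallest labels of the subtrees above its inputs increase from left to right). Order the shuffle trees path-lexicographically with $\alpha<i<l<r$: compare the arities; if they are equal, compare lexicographically the vectors $(a_1,\dots,a_n)$, where $a_j$ is the word of vertices on the path from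 the root to the leaf labelled $j$ and words are compared degree-lexicographically; if these are equal, compare the sequences of leaf labels, read from left to right, in the reverse lexicographic order. Then the $\Sigma_3$- and $\Sigma_2$-orbits of the above defining relations, written in shuffle trees, constitute a quadratic Gröbner basis of the ideal of relations of $\mathrm{ICom}$ (the kernel of the map from the free shuffle operad to $\mathrm{ICom}$): every monomial in them has exactly two vertices, they generate this ideal as an ideal of the free shuffle operad, and the leading term of every non-zero element of the ideal is divisible by the leading term of one of them. Moreover, all components $\mathrm{ICom}(n,\chi,c)$ are finite-dimensional, and the generating series $$F^{c}(t_1,t_2)=\sum_{m_1,m_2\ge 0}\frac{\dim \mathrm{ICom}(m_1+m_2,\chi,c)}{m_1!\,m_2!}\,t_1^{m_1}t_2^{m_2}$$ (where $\chi$ is any colouring of the $m_1+m_2$ inputs with $m_1$ inputs of the first and $m_2$ of the second colour, and $c$ is the output colour) are $$(F^1,F^2)=\left(e^{t_1+t_2}-1,\; e^{t_1+t_2}-e^{t_1}\right).$$ -/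

import Mathlib

set_option maxSynthPendingDepth 3

namespace ICom

/-! ### Colours, generators and planar tree monomials -/

/-- The two colours: `alg` is the first colour (elements of the algebra, solid edges, variable `t₁`),
`idl` is the second colour (elements of the ideal, dotted edges, variable `t₂`). -/
inductive Colour where
  | alg
  | idl
  deriving DecidableEq

/-- A finite coloured set of labels: the graph `{(a, χ a)}` of a colouring of a finite subset of `ℕ`.
It is ordered through the order of `ℕ`. -/
abbrev CSet := Finset (ℕ × Colour)

/-- The underlying set of labels. -/
def CSet.labels (X : CSet) : Set ℕ := {a | ∃ c, (a, c) ∈ X}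

/-- The coloured set `({1, …, n}, χ)`. -/
def CSet.standard {n : ℕ} (χ : Fin n → Colour) : CSet :=
  Finset.univ.image fun j : Fin n => ((j : ℕ) + 1, χ j)

/-- Well-coloured planar rooted trees with labelled leaves whose vertices are decorated by the four
generators `i : idl → alg`, `α : alg, alg → alg`, `l : alg, idl → idl`, `r : idl, alg → idl`;
the index is the output colour.  `leaf c a` is the degenerate tree of colour `c` with label `a`. -/
inductive Mon : Colour → Type where
  | leaf (c : Colour) (a : ℕ) : Mon c
  | i (t : Mon .idl) : Mon .alg
  | α (s : Mon .alg) (t : Mon .alg) : Mon .alg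
  | l (s : Mon .alg) (t : Mon .idl) : Mon .idl
  | r (s : Mon .idl) (t : Mon .alg) : Mon .idl

/-- The names of the four generators. -/
inductive Gen where
  | α
  | i
  | l
  | r

/-- The ordering `α < i < l < r` of the generators. -/
def Gen.rank : Gen → ℕ
  | .α => 0
  | .i => 1
  | .l => 2
  | .r => 3

def Gen.lt (g h : Gen) : Prop := g.rank < h.rank

namespace Mon

/-- The leaves (label and colour), read from left to right. -/
def leaves : {c : Colour} → Mon c → List (ℕ × Colour)
  | _, .leaf c a => [(a, c)]
  | _, .i t => t.leaves
  | _, .α s t => s.leaves ++ t.leaves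
  | _, .l s t => s.leaves ++ t.leaves
  | _, .r s t => s.leaves ++ t.leaves

/-- The labels of the leaves, read from left to right. -/
def labels {c : Colour} (T : Mon c) : List ℕ := T.leaves.map Prod.fst

/-- The leaves of `T` are labelled bijectively by the coloured set `X`. -/
def HasLeaves {c : Colour} (T : Mon c) (X : CSet) : Prop :=
  T.labels.Nodup ∧ T.leaves.toFinset = X

/-- The number of inner vertices (operation degree). -/
def vertices : {c : Colour} → Mon c → ℕ
  | _, .leaf _ _ => 0
  | _, .i t => t.vertices + 1
  | _, .α s t => s.vertices + t.vertices + 1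
  | _, .l s t => s.vertices + t.vertices + 1
  | _, .r s t => s.vertices + t.vertices + 1

/-- The smallest label of a leaf. -/
def minLabel : {c : Colour} → Mon c → ℕ
  | _, .leaf _ a => a
  | _, .i t => t.minLabel
  | _, .α s t => min s.minLabel t.minLabel
  | _, .l s t => min s.minLabel t.minLabel
  | _, .r s t => min s.minLabel t.minLabel

/-- The shuffle condition: at every vertex the smallest labels of the subtrees growing from its
inputs increase from left to right. -/
def IsShuffle : {c : Colour} → Mon c → Prop
  | _, .leaf _ _ => True
  | _, .i t => t.IsShuffle
  | _, .α s t => s.minLabel < t.minLabel ∧ s.IsShuffle ∧ t.IsShuffle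
  | _, .l s t => s.minLabel < t.minLabel ∧ s.IsShuffle ∧ t.IsShuffle
  | _, .r s t => s.minLabel < t.minLabel ∧ s.IsShuffle ∧ t.IsShuffle

/-- Simultaneous grafting: the leaf with colour `c` and label `a` is replaced by `σ c a`. -/
def subst (σ : (c : Colour) → ℕ → Mon c) : {c : Colour} → Mon c → Mon c
  | _, .leaf c a => σ c a
  | _, .i t => .i (t.subst σ)
  | _, .α s t => .α (s.subst σ) (t.subst σ)
  | _, .l s t => .l (s.subst σ) (t.subst σ)
  | _, .r s t => .r (s.subst σ) (t.subst σ)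

/-- Change of the labels along `φ`. -/
def relabel (φ : ℕ → ℕ) {c : Colour} (T : Mon c) : Mon c :=
  T.subst fun c a => .leaf c (φ a)

/-- The substitution that puts `S` at the leaf with label `a` and the colour of `S`. -/
def plug (a : ℕ) {d : Colour} (S : Mon d) (c : Colour) (b : ℕ) : Mon c :=
  if h : d = c ∧ b = a then h.1 ▸ S else .leaf c b

/-- Partial composition `T ∘_a S`: graft `S` on the input of `T` labelled `a`. -/
def graft {c d : Colour} (a : ℕ) (T : Mon c) (S : Mon d) : Mon c :=
  T.subst (plug a S)

/-- `U.IsSubtreeOf T`: `U` consists of some edge of `T` and of everything above it. -/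
inductive IsSubtreeOf {d : Colour} (U : Mon d) : {c : Colour} → Mon c → Prop
  | self : IsSubtreeOf U U
  | i {t : Mon .idl} : IsSubtreeOf U t → IsSubtreeOf U (.i t)
  | α_left {s t : Mon .alg} : IsSubtreeOf U s → IsSubtreeOf U (.α s t)
  | α_right {s t : Mon .alg} : IsSubtreeOf U t → IsSubtreeOf U (.α s t)
  | l_left {s : Mon .alg} {t : Mon .idl} : IsSubtreeOf U s → IsSubtreeOf U (.l s t)
  | l_right {s : Mon .alg} {t : Mon .idl} : IsSubtreeOf U t → IsSubtreeOf U (.l s t)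
  | r_left {s : Mon .idl} {t : Mon .alg} : IsSubtreeOf U s → IsSubtreeOf U (.r s t)
  | r_right {s : Mon .idl} {t : Mon .alg} : IsSubtreeOf U t → IsSubtreeOf U (.r s t)

/-- `S.Divides T`: somewhere inside `T` there is a copy of `S`, with subtrees `σ c a` of `T` growing
from the leaves `(a, c)` of `S`, such that the order of the labels of `S` is the order of the smallest
labels of these subtrees (smallest descendant ordering). -/
def Divides {d c : Colour} (S : Mon d) (T : Mon c) : Prop :=
  ∃ σ : (c : Colour) → ℕ → Mon c, (S.subst σ).IsSubtreeOf T ∧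
    ∀ p ∈ S.leaves, ∀ q ∈ S.leaves, p.1 < q.1 →
      (σ p.2 p.1).minLabel < (σ q.2 q.1).minLabel

/-! ### The path-lexicographic ordering -/

/-- The word of the vertices on the path from the root to the leaf labelled `a`. -/
def path (a : ℕ) : {c : Colour} → Mon c → List Gen
  | _, .leaf _ _ => []
  | _, .i t => .i :: t.path a
  | _, .α s t => .α :: if a ∈ s.labels then s.path a else t.path a
  | _, .l s t => .l :: if a ∈ s.labels then s.path a else t.path a
  | _, .r s t => .r :: if a ∈ s.labels then s.path a else t.path a

/-- The vector `(a₁, …, aₙ)` of the path words, listed by increasing label of the leaf. -/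
def pathVector {c : Colour} (T : Mon c) : List (List Gen) :=
  (T.labels.insertionSort (· ≤ ·)).map fun a => T.path a

/-- The path-lexicographic ordering: compare first the arities, then the vectors of path words
(lexicographically, words being compared degree-lexicographically), then the sequences of labels
in the reverse lexicographic order. -/
def PathLexLT {c : Colour} (T T' : Mon c) : Prop :=
  T.leaves.length < T'.leaves.length ∨
  (T.leaves.length = T'.leaves.length ∧
    (List.Lex (List.Shortlex Gen.lt) T.pathVector T'.pathVector ∨
      (T.pathVector = T'.pathVector ∧ List.Lex (· < ·) T'.labels T.labels)))

/-! ### Tree monomials of the free symmetric operad -/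

/-- `Same T T'`: `T` and `T'` are planar representations of the same non-planar decorated tree, where
the symmetric group `Σ₂` fixes `α` and exchanges `l` and `r`. -/
inductive Same : {c : Colour} → Mon c → Mon c → Prop
  | refl {c : Colour} (T : Mon c) : Same T T
  | symm {c : Colour} {T T' : Mon c} : Same T T' → Same T' T
  | trans {c : Colour} {T T' T'' : Mon c} : Same T T' → Same T' T'' → Same T T''
  | swap_α (s t : Mon .alg) : Same (.α s t) (.α t s)
  | swap_r (s : Mon .idl) (t : Mon .alg) : Same (.r s t) (.l t s)
  | congr_i {t t' : Mon .idl} : Same t t' → Same (.i t) (.i t')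
  | congr_α {s s' t t' : Mon .alg} : Same s s' → Same t t' → Same (.α s t) (.α s' t')
  | congr_l {s s' : Mon .alg} {t t' : Mon .idl} :
      Same s s' → Same t t' → Same (.l s t) (.l s' t')
  | congr_r {s s' : Mon .idl} {t t' : Mon .alg} :
      Same s s' → Same t t' → Same (.r s t) (.r s' t')

theorem Same.leaves_perm {c : Colour} {T T' : Mon c} (h : Same T T') :
    T.leaves.Perm T'.leaves := by
  induction h with
  | refl T => exact List.Perm.refl _
  | symm _ ih => exact ih.symm
  | trans _ _ ih₁ ih₂ => exact ih₁.trans ih₂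
  | swap_α s t => exact List.perm_append_comm
  | swap_r s t => exact List.perm_append_comm
  | congr_i _ ih => exact ih
  | congr_α _ _ ih₁ ih₂ => exact ih₁.append ih₂
  | congr_l _ _ ih₁ ih₂ => exact ih₁.append ih₂
  | congr_r _ _ ih₁ ih₂ => exact ih₁.append ih₂

theorem Same.hasLeaves_iff {c : Colour} {T T' : Mon c} (h : Same T T') (X : CSet) :
    T.HasLeaves X ↔ T'.HasLeaves X := by
  have hp := h.leaves_perm
  unfold HasLeaves labels
  rw [(hp.map Prod.fst).nodup_iff, List.toFinset_eq_of_perm _ _ hp]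

theorem Same.subst_right {c : Colour} (T : Mon c) {σ τ : (c : Colour) → ℕ → Mon c}
    (h : ∀ c a, Same (σ c a) (τ c a)) : Same (T.subst σ) (T.subst τ) := by
  induction T with
  | leaf c a => exact h c a
  | i t ih => exact .congr_i ih
  | α s t ih₁ ih₂ => exact .congr_α ih₁ ih₂
  | l s t ih₁ ih₂ => exact .congr_l ih₁ ih₂
  | r s t ih₁ ih₂ => exact .congr_r ih₁ ih₂

theorem Same.subst_left {c : Colour} {T T' : Mon c} (h : Same T T')
    (σ : (c : Colour) → ℕ → Mon c) : Same (T.subst σ) (T'.subst σ) := by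
  induction h with
  | refl T => exact .refl _
  | symm _ ih => exact ih.symm
  | trans _ _ ih₁ ih₂ => exact ih₁.trans ih₂
  | swap_α s t => exact .swap_α _ _
  | swap_r s t => exact .swap_r _ _
  | congr_i _ ih => exact .congr_i ih
  | congr_α _ _ ih₁ ih₂ => exact .congr_α ih₁ ih₂
  | congr_l _ _ ih₁ ih₂ => exact .congr_l ih₁ ih₂
  | congr_r _ _ ih₁ ih₂ => exact .congr_r ih₁ ih₂

theorem Same.plug {d : Colour} {S S' : Mon d} (h : Same S S') (a : ℕ) (c : Colour) (b : ℕ) :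
    Same (Mon.plug a S c b) (Mon.plug a S' c b) := by
  unfold Mon.plug
  split
  next hh =>
    obtain ⟨rfl, _⟩ := hh
    exact h
  next => exact .refl _

instance planarSetoid (c : Colour) : Setoid (Mon c) where
  r := Same
  iseqv := ⟨Same.refl, Same.symm, Same.trans⟩

end Mon

/-- Non-planar tree monomials: the monomial basis of the free symmetric coloured operad on the
generators `i`, `α`, `r` with `α(1,2) = α(2,1)` (and `l(1,2) := r(2,1)`). -/
def SMon (c : Colour) : Type := Quotient (Mon.planarSetoid c)

namespace SMon

/-- The non-planar tree of a planar one. -/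
def mk {c : Colour} (T : Mon c) : SMon c := Quotient.mk _ T

def HasLeaves {c : Colour} (T : SMon c) (X : CSet) : Prop :=
  Quotient.lift (fun T : Mon c => T.HasLeaves X)
    (fun _ _ h => propext (Mon.Same.hasLeaves_iff h X)) T

def relabel (φ : ℕ → ℕ) {c : Colour} : SMon c → SMon c :=
  Quotient.map (Mon.relabel φ) fun _ _ h => Mon.Same.subst_left h _

def graft {c d : Colour} (a : ℕ) : SMon c → SMon d → SMon c :=
  Quotient.map₂ (Mon.graft a) fun _ _ h _ _ h' =>
    (Mon.Same.subst_left h _).trans (Mon.Same.subst_right _ fun c b => h'.plug a c b)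

end SMon

/-! ### Free operads, ideals, and the operad of a commutative algebra with an ideal -/

section Operads

variable (k : Type*) [Field k]

/-- The component of the free symmetric coloured operad with inputs `X` and output colour `c`. -/
def FreeSym (X : CSet) (c : Colour) : Submodule k (SMon c →₀ k) :=
  Finsupp.supported k k {T | T.HasLeaves X}

/-- The component of the free shuffle coloured operad on `i, α, l, r` with inputs `X` and output
colour `c`. -/
def FreeSh (X : CSet) (c : Colour) : Submodule k (Mon c →₀ k) :=
  Finsupp.supported k k {T | T.IsShuffle ∧ T.HasLeaves X}

variable {k}

/-- Membership in the component `(X, c)` of the operadic ideal generated by `R` in the free symmetric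
coloured operad: the smallest collection of subspaces that contains `R` and is closed under
bijections of the labels and under partial compositions, on either side, with arbitrary elements
(by linearity: with arbitrary monomials) of the free operad. -/
inductive InSymIdeal (R : (c : Colour) → Set (SMon c →₀ k)) :
    CSet → (c : Colour) → (SMon c →₀ k) → Prop
  | rel {X : CSet} {c : Colour} {f : SMon c →₀ k} :
      f ∈ R c → f ∈ FreeSym k X c → InSymIdeal R X c f
  | zero {X : CSet} {c : Colour} : InSymIdeal R X c 0
  | add {X : CSet} {c : Colour} {f g : SMon c →₀ k} :
      InSymIdeal R X c f → InSymIdeal R X c g → InSymIdeal R X c (f + g)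
  | smul {X : CSet} {c : Colour} {f : SMon c →₀ k} (x : k) :
      InSymIdeal R X c f → InSymIdeal R X c (x • f)
  | relabel {X : CSet} {c : Colour} {f : SMon c →₀ k} (φ : ℕ → ℕ) :
      Set.InjOn φ X.labels → InSymIdeal R X c f →
      InSymIdeal R (X.image (Prod.map φ id)) c (f.mapDomain (SMon.relabel φ))
  | comp_right {X Y : CSet} {c d : Colour} {a : ℕ} {f : SMon c →₀ k} {S : SMon d} :
      InSymIdeal R X c f → S.HasLeaves Y → (a, d) ∈ X →
      Disjoint (CSet.labels (X.erase (a, d))) Y.labels →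
      InSymIdeal R (X.erase (a, d) ∪ Y) c (f.mapDomain fun T => T.graft a S)
  | comp_left {X Y : CSet} {c d : Colour} {a : ℕ} {T : SMon c} {f : SMon d →₀ k} :
      T.HasLeaves X → InSymIdeal R Y d f → (a, d) ∈ X →
      Disjoint (CSet.labels (X.erase (a, d))) Y.labels →
      InSymIdeal R (X.erase (a, d) ∪ Y) c (f.mapDomain fun S => T.graft a S)

/-- Membership in the component `(X, c)` of the operadic ideal generated by `G` in the free shuffle
coloured operad.  Only order-preserving changes of labels are allowed, and only shuffle compositions
`T ∘_a S`: those where `a` is the smallest label of `S`. -/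
inductive InShIdeal (G : (c : Colour) → Set (Mon c →₀ k)) :
    CSet → (c : Colour) → (Mon c →₀ k) → Prop
  | rel {X : CSet} {c : Colour} {f : Mon c →₀ k} :
      f ∈ G c → f ∈ FreeSh k X c → InShIdeal G X c f
  | zero {X : CSet} {c : Colour} : InShIdeal G X c 0
  | add {X : CSet} {c : Colour} {f g : Mon c →₀ k} :
      InShIdeal G X c f → InShIdeal G X c g → InShIdeal G X c (f + g)
  | smul {X : CSet} {c : Colour} {f : Mon c →₀ k} (x : k) :
      InShIdeal G X c f → InShIdeal G X c (x • f)
  | relabel {X : CSet} {c : Colour} {f : Mon c →₀ k} (φ : ℕ → ℕ) :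
      StrictMonoOn φ X.labels → InShIdeal G X c f →
      InShIdeal G (X.image (Prod.map φ id)) c (f.mapDomain (Mon.relabel φ))
  | comp_right {X Y : CSet} {c d : Colour} {a : ℕ} {f : Mon c →₀ k} {S : Mon d} :
      InShIdeal G X c f → S.IsShuffle → S.HasLeaves Y → (a, d) ∈ X → IsLeast Y.labels a →
      Disjoint (CSet.labels (X.erase (a, d))) Y.labels →
      InShIdeal G (X.erase (a, d) ∪ Y) c (f.mapDomain fun T => T.graft a S)
  | comp_left {X Y : CSet} {c d : Colour} {a : ℕ} {T : Mon c} {f : Mon d →₀ k} :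
      T.IsShuffle → T.HasLeaves X → InShIdeal G Y d f → (a, d) ∈ X → IsLeast Y.labels a →
      Disjoint (CSet.labels (X.erase (a, d))) Y.labels →
      InShIdeal G (X.erase (a, d) ∪ Y) c (f.mapDomain fun S => T.graft a S)

/-- The component `(X, c)` of the ideal generated by `R` in the free symmetric operad. -/
def symIdeal (R : (c : Colour) → Set (SMon c →₀ k)) (X : CSet) (c : Colour) :
    Submodule k (SMon c →₀ k) where
  carrier := {f | InSymIdeal R X c f}
  add_mem' := InSymIdeal.add
  zero_mem' := InSymIdeal.zero
  smul_mem' x _ := InSymIdeal.smul x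

/-- The component `(X, c)` of the ideal generated by `G` in the free shuffle operad. -/
def shIdeal (G : (c : Colour) → Set (Mon c →₀ k)) (X : CSet) (c : Colour) :
    Submodule k (Mon c →₀ k) where
  carrier := {f | InShIdeal G X c f}
  add_mem' := InShIdeal.add
  zero_mem' := InShIdeal.zero
  smul_mem' x _ := InShIdeal.smul x

/-- `T` is the leading term (its monomial) of `f`: the largest monomial in the expansion of `f`. -/
def IsLeadingTerm {c : Colour} (lt : Mon c → Mon c → Prop) (T : Mon c) (f : Mon c →₀ k) : Prop :=
  T ∈ f.support ∧ ∀ T' ∈ f.support, T' ≠ T → lt T' T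

/-- `G` is a Gröbner basis of the operadic ideal `M` of the free shuffle operad: `G` lies in the free
shuffle operad and generates `M`, and the leading term of every non-zero element of `M` exists and is
divisible by the leading term of some element of `G`. -/
structure IsGroebnerBasis (lt : (c : Colour) → Mon c → Mon c → Prop)
    (G : (c : Colour) → Set (Mon c →₀ k))
    (M : CSet → (c : Colour) → Submodule k (Mon c →₀ k)) : Prop where
  homogeneous : ∀ c, ∀ g ∈ G c, ∃ X, g ∈ FreeSh k X c
  generates : ∀ X c, shIdeal G X c = M X c
  leading : ∀ X c, ∀ f ∈ M X c, f ≠ 0 →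
    ∃ T, IsLeadingTerm (lt c) T f ∧
      ∃ d, ∃ g ∈ G d, ∃ S, IsLeadingTerm (lt d) S g ∧ S.Divides T

/-- All monomials of the elements of `G` have exactly two vertices. -/
def IsQuadratic (G : (c : Colour) → Set (Mon c →₀ k)) : Prop :=
  ∀ c, ∀ g ∈ G c, ∀ T ∈ g.support, T.vertices = 2

variable (k)

/-- A tree monomial as an element of the free symmetric operad. -/
noncomputable def mon {c : Colour} (T : Mon c) : SMon c →₀ k := Finsupp.single (SMon.mk T) 1

open Mon in
/-- The defining relations, with their arities and output colours: `α` is associative (and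
commutative), `r` is an action of the algebra, `i` is a map of modules, and
`r(1, i(2)) = r(2, i(1))`. -/
inductive DefRel : ℕ → (c : Colour) → (SMon c →₀ k) → Prop
  | com₁ : DefRel 3 .alg (mon k (α (α (leaf _ 1) (leaf _ 2)) (leaf _ 3))
      - mon k (α (α (leaf _ 1) (leaf _ 3)) (leaf _ 2)))
  | com₂ : DefRel 3 .alg (mon k (α (α (leaf _ 1) (leaf _ 3)) (leaf _ 2))
      - mon k (α (leaf _ 1) (α (leaf _ 2) (leaf _ 3))))
  | act₁ : DefRel 3 .idl (mon k (r (r (leaf _ 1) (leaf _ 2)) (leaf _ 3))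
      - mon k (r (r (leaf _ 1) (leaf _ 3)) (leaf _ 2)))
  | act₂ : DefRel 3 .idl (mon k (r (r (leaf _ 1) (leaf _ 3)) (leaf _ 2))
      - mon k (r (leaf _ 1) (α (leaf _ 2) (leaf _ 3))))
  | hom : DefRel 2 .alg (mon k (α (i (leaf _ 1)) (leaf _ 2))
      - mon k (i (r (leaf _ 1) (leaf _ 2))))
  | sym : DefRel 2 .idl (mon k (r (leaf _ 1) (i (leaf _ 2)))
      - mon k (r (leaf _ 2) (i (leaf _ 1))))

/-- The ideal of relations of the symmetric coloured operad `ICom`. -/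
def relIdeal (X : CSet) (c : Colour) : Submodule k (SMon c →₀ k) :=
  symIdeal (fun c => {f | ∃ n, DefRel k n c f}) X c

/-- The component of the symmetric coloured operad `ICom` with inputs `X` and output colour `c`. -/
abbrev Operad (X : CSet) (c : Colour) : Type _ :=
  FreeSym k X c ⧸ (relIdeal k X c).submoduleOf (FreeSym k X c)

/-- The map that forgets the planar structure of trees; restricted to shuffle trees, it identifies
the free shuffle operad with the shuffle operad underlying the free symmetric operad. -/
noncomputable def forgetPlanar (c : Colour) : (Mon c →₀ k) →ₗ[k] (SMon c →₀ k) :=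
  Finsupp.lmapDomain k k SMon.mk

/-- The ideal of relations of the shuffle operad underlying `ICom`: the elements of the free shuffle
operad that vanish in `ICom`. -/
noncomputable def shRelIdeal (X : CSet) (c : Colour) : Submodule k (Mon c →₀ k) :=
  FreeSh k X c ⊓ (relIdeal k X c).comap (forgetPlanar k c)

/-- The orbits of the defining relations of arity `n` under the permutations `σ` of `{1, …, n}`,
written through shuffle trees. -/
def shRelations (c : Colour) : Set (Mon c →₀ k) :=
  {g | (∃ X, g ∈ FreeSh k X c) ∧ ∃ n f, DefRel k n c f ∧ ∃ σ : Equiv.Perm ℕ,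
    σ '' Set.Icc 1 n = Set.Icc 1 n ∧ forgetPlanar k c g = f.mapDomain (SMon.relabel σ)}

end Operads

/-! ### Generating series -/

/-- The vector of the numbers of elements of each colour. -/
noncomputable def weight {n : ℕ} (χ : Fin n → Colour) : Colour →₀ ℕ :=
  ∑ j, Finsupp.single (χ j) 1

/-- `F` is the vector of exponential generating series of the dimensions `dim(n, χ, c)` of a coloured
symmetric collection: the coefficient of `t₁ ^ m₁ t₂ ^ m₂` in `F c` is `dim(n, χ, c) / (m₁! m₂!)`,
for every colouring `χ` of `{1, …, n}` with `m₁` elements of the first and `m₂` elements of the second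
colour. -/
def IsGeneratingSeries (dim : (n : ℕ) → (Fin n → Colour) → Colour → ℕ)
    (F : Colour → MvPowerSeries Colour ℚ) : Prop :=
  ∀ (n : ℕ) (χ : Fin n → Colour) (c : Colour),
    MvPowerSeries.coeff (weight χ) (F c)
      = (dim n χ c : ℚ) / ((weight χ .alg).factorial * (weight χ .idl).factorial : ℕ)

/-- The formal power series `exp f`, for `f` without constant term. -/
noncomputable def expSeries (f : MvPowerSeries Colour ℚ) : MvPowerSeries Colour ℚ :=
  (PowerSeries.exp ℚ).subst f

/-- The series `(e^{t₁+t₂} - 1, e^{t₁+t₂} - e^{t₁})`. -/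
noncomputable def series : Colour → MvPowerSeries Colour ℚ
  | .alg => expSeries (MvPowerSeries.X .alg + MvPowerSeries.X .idl) - 1
  | .idl => expSeries (MvPowerSeries.X .alg + MvPowerSeries.X .idl)
      - expSeries (MvPowerSeries.X .alg)

end ICom

/-!
All defining relations of `ICom` are differences of two tree monomials, so they are killed by the sum
of the coefficients. The point is that nothing else survives: any two tree monomials with the same
inputs and the same output colour become equal in `ICom`. Hence the ideal of relations, symmetric or
shuffle, consists of the elements with coefficient sum zero (`mem_relIdeal_iff`,
`mem_shRelIdeal_iff`), and a component of `ICom` has dimension one if some tree has these inputs and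
this output, and zero otherwise. A tree with output in the algebra exists as soon as there is an
input, and a tree with output in the ideal as soon as there is an input of the second colour; this
gives the generating series.

The orbits of the relations contain, up to sign, the differences of the two sides of eleven rewriting
rules `Rule S S'` between shuffle trees with `S' < S`. The trees that are not divisible by a left
hand side `S` are the right combs described by `Mon.Normal` (`normal_or_exists_divides`).

* By the rules, the leaf with the smallest label can be pulled down to the root
  (`exists_cong_headed`); an induction on the number of leaves shows that every shuffle tree is
  congruent to a normal one modulo the shuffle ideal generated by the relations
  (`exists_cong_normal`).
* A normal tree is smaller than every other shuffle tree with the same leaves and the same output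
  (`Mon.Normal.eq_or_lex`): the two trees are compared at the smallest label, where the path word of
  the normal tree is as small as possible, and if the words agree there, then both trees start in the
  same way and induction applies. In particular normal trees are unique, and all shuffle trees with
  the same leaves and output are congruent (`cong_of_leafSet_eq`).
* The ordering is total on the shuffle trees with given leaves, because a planar tree can be read off
  from its path words and labels (`Mon.code_append_injective`). So a non-zero element of the ideal has
  a leading term. If this were normal, it would be the only term, by minimality, and the coefficient
  sum would not vanish (`not_normal_of_isLeadingTerm`). So it is divisible by the leading term of a
  relation, and no compatibility of the ordering with compositions is needed.
-/

namespace ICom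

/-! ### Leaves, smallest labels, grafting and relabelling of planar trees -/

namespace Mon

variable {c d : Colour}

/-- The coloured set of the leaves of a tree. -/
def leafSet (T : Mon c) : CSet := T.leaves.toFinset

theorem mem_leafSet {T : Mon c} {p : ℕ × Colour} : p ∈ T.leafSet ↔ p ∈ T.leaves :=
  List.mem_toFinset

@[simp] theorem labels_leaf (a : ℕ) : (leaf c a).labels = [a] := rfl
@[simp] theorem labels_i (t : Mon .idl) : (i t).labels = t.labels := rfl
@[simp] theorem labels_α (s t : Mon .alg) : (α s t).labels = s.labels ++ t.labels := by
  simp [labels, leaves]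
@[simp] theorem labels_l (s : Mon .alg) (t : Mon .idl) : (l s t).labels = s.labels ++ t.labels := by
  simp [labels, leaves]
@[simp] theorem labels_r (s : Mon .idl) (t : Mon .alg) : (r s t).labels = s.labels ++ t.labels := by
  simp [labels, leaves]

theorem mem_labels {T : Mon c} {a : ℕ} : a ∈ T.labels ↔ ∃ e, (a, e) ∈ T.leaves := by
  simp [labels]

theorem mem_labels_of_mem {T : Mon c} {p : ℕ × Colour} (h : p ∈ T.leaves) : p.1 ∈ T.labels :=
  List.mem_map_of_mem h

theorem mem_labels_leafSet {T : Mon c} {a : ℕ} : a ∈ CSet.labels T.leafSet ↔ a ∈ T.labels := by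
  simp [CSet.labels, mem_labels, mem_leafSet]

theorem mem_labels_iff_of_leafSet_eq {T : Mon c} {T' : Mon d} (h : T.leafSet = T'.leafSet) {a : ℕ} :
    a ∈ T.labels ↔ a ∈ T'.labels := by
  rw [← mem_labels_leafSet, h, mem_labels_leafSet]

theorem leaves_ne_nil (T : Mon c) : T.leaves ≠ [] := by
  induction T <;> simp_all [leaves]

theorem leaves_nodup {T : Mon c} (h : T.labels.Nodup) : T.leaves.Nodup := List.Nodup.of_map _ h

theorem leaves_perm_of_leafSet_eq {T : Mon c} {T' : Mon d} (h : T.labels.Nodup)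
    (h' : T'.labels.Nodup) (e : T.leafSet = T'.leafSet) : T.leaves.Perm T'.leaves :=
  List.perm_of_nodup_nodup_toFinset_eq (leaves_nodup h) (leaves_nodup h') e

theorem labels_perm_of_leafSet_eq {T : Mon c} {T' : Mon d} (h : T.labels.Nodup)
    (h' : T'.labels.Nodup) (e : T.leafSet = T'.leafSet) : T.labels.Perm T'.labels :=
  (leaves_perm_of_leafSet_eq h h' e).map _

/-- In a tree with distinct labels the label of a leaf determines its colour. -/
theorem eq_of_mem_leaves {T : Mon c} (h : T.labels.Nodup) {a : ℕ} {e e' : Colour}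
    (h₁ : (a, e) ∈ T.leaves) (h₂ : (a, e') ∈ T.leaves) : e = e' := by
  have := List.inj_on_of_nodup_map h h₁ h₂ rfl
  simpa using this

theorem minLabel_mem (T : Mon c) : T.minLabel ∈ T.labels := by
  induction T with
  | leaf c a => simp [minLabel]
  | i t ih => simpa [minLabel] using ih
  | α s t ih₁ ih₂ | l s t ih₁ ih₂ | r s t ih₁ ih₂ =>
    simp only [minLabel, labels_α, labels_l, labels_r, List.mem_append]
    rcases min_choice s.minLabel t.minLabel with h | h <;> simp [h, ih₁, ih₂]

theorem minLabel_le {T : Mon c} {a : ℕ} (h : a ∈ T.labels) : T.minLabel ≤ a := by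
  induction T with
  | leaf c b => simp_all [minLabel]
  | i t ih => exact ih (by simpa using h)
  | α s t ih₁ ih₂ | l s t ih₁ ih₂ | r s t ih₁ ih₂ =>
    simp only [minLabel, labels_α, labels_l, labels_r, List.mem_append, min_le_iff] at h ⊢
    exact h.imp ih₁ ih₂

theorem minLabel_eq_of_leafSet_eq {T : Mon c} {T' : Mon d} (h : T.leafSet = T'.leafSet) :
    T.minLabel = T'.minLabel :=
  le_antisymm (minLabel_le ((mem_labels_iff_of_leafSet_eq h).2 T'.minLabel_mem))
    (minLabel_le ((mem_labels_iff_of_leafSet_eq h).1 T.minLabel_mem))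

theorem isLeast_minLabel (T : Mon c) : IsLeast (CSet.labels T.leafSet) T.minLabel :=
  ⟨mem_labels_leafSet.2 T.minLabel_mem, fun _ h => minLabel_le (mem_labels_leafSet.1 h)⟩

theorem minLabel_ne {s : Mon c} {t : Mon d} (h : s.labels.Disjoint t.labels) :
    s.minLabel ≠ t.minLabel := fun e => h s.minLabel_mem (e ▸ t.minLabel_mem)

@[simp] theorem leafSet_i (t : Mon .idl) : (i t).leafSet = t.leafSet := rfl
@[simp] theorem leafSet_α (s t : Mon .alg) : (α s t).leafSet = s.leafSet ∪ t.leafSet := by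
  simp [leafSet, leaves]
@[simp] theorem leafSet_l (s : Mon .alg) (t : Mon .idl) :
    (l s t).leafSet = s.leafSet ∪ t.leafSet := by
  simp [leafSet, leaves]
@[simp] theorem leafSet_r (s : Mon .idl) (t : Mon .alg) :
    (r s t).leafSet = s.leafSet ∪ t.leafSet := by
  simp [leafSet, leaves]
@[simp] theorem leafSet_leaf (a : ℕ) : (leaf c a).leafSet = {(a, c)} := rfl

/-- The leftmost leaf of a shuffle tree carries the smallest label. -/
theorem IsShuffle.labels_eq_cons {T : Mon c} (h : T.IsShuffle) :
    ∃ L, T.labels = T.minLabel :: L := by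
  induction T with
  | leaf c a => exact ⟨[], rfl⟩
  | i t ih => exact ih h
  | α s t ih₁ ih₂ | l s t ih₁ ih₂ | r s t ih₁ ih₂ =>
    obtain ⟨L, hL⟩ := ih₁ h.2.1
    exact ⟨L ++ t.labels, by simp [hL, minLabel, h.1.le]⟩

/-! #### Grafting -/

section Graft

variable {e : Colour}

@[simp] theorem plug_self (a : ℕ) (S : Mon d) : plug a S d a = S := by simp [plug]

theorem plug_of_ne {a b : ℕ} (S : Mon d) (h : b ≠ a) : plug a S c b = leaf c b := by simp [plug, h]

@[simp] theorem graft_leaf (a b : ℕ) (S : Mon d) : (leaf c b).graft a S = plug a S c b := rfl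
@[simp] theorem graft_i (a : ℕ) (t : Mon .idl) (S : Mon d) :
    (i t).graft a S = i (t.graft a S) := rfl
@[simp] theorem graft_α (a : ℕ) (s t : Mon .alg) (S : Mon d) :
    (α s t).graft a S = α (s.graft a S) (t.graft a S) := rfl
@[simp] theorem graft_l (a : ℕ) (s : Mon .alg) (t : Mon .idl) (S : Mon d) :
    (l s t).graft a S = l (s.graft a S) (t.graft a S) := rfl
@[simp] theorem graft_r (a : ℕ) (s : Mon .idl) (t : Mon .alg) (S : Mon d) :
    (r s t).graft a S = r (s.graft a S) (t.graft a S) := rfl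

theorem graft_of_not_mem {a : ℕ} {T : Mon c} (S : Mon d) (h : a ∉ T.labels) :
    T.graft a S = T := by
  induction T with
  | leaf c b =>
    simp only [labels_leaf, List.mem_singleton] at h
    exact plug_of_ne S (Ne.symm h)
  | i t ih => simpa using ih h
  | α s t ih₁ ih₂ | l s t ih₁ ih₂ | r s t ih₁ ih₂ =>
    simp only [labels_α, labels_l, labels_r, List.mem_append, not_or] at h
    simp [ih₁ h.1, ih₂ h.2]

theorem mem_leaves_graft {a : ℕ} {T : Mon c} {S : Mon d} {p : ℕ × Colour} :
    p ∈ (T.graft a S).leaves ↔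
      (p ∈ T.leaves ∧ p ≠ (a, d)) ∨ ((a, d) ∈ T.leaves ∧ p ∈ S.leaves) := by
  induction T with
  | leaf c b =>
    by_cases h : d = c ∧ b = a
    · obtain ⟨rfl, rfl⟩ := h
      simp [leaves]
    · have : ¬ (a, d) = (b, c) := by simp; tauto
      have h2 : (b, c) ≠ (a, d) := Ne.symm this
      simp only [graft_leaf, plug, dif_neg h, leaves, List.mem_singleton, this, false_and, or_false]
      constructor
      · rintro rfl; exact ⟨rfl, h2⟩
      · exact fun h => h.1
  | i t ih => simpa [leaves] using ih
  | α s t ih₁ ih₂ | l s t ih₁ ih₂ | r s t ih₁ ih₂ =>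
    simp only [graft_α, graft_l, graft_r, leaves, List.mem_append, ih₁, ih₂, or_and_right]
    exact or_or_or_comm

theorem leafSet_graft {a : ℕ} {T : Mon c} {S : Mon d} (h : (a, d) ∈ T.leafSet) :
    (T.graft a S).leafSet = T.leafSet.erase (a, d) ∪ S.leafSet := by
  ext p
  rw [mem_leafSet, mem_leaves_graft]
  simp only [mem_leafSet, Finset.mem_union, Finset.mem_erase] at h ⊢
  tauto

theorem disjoint_labels_graft {a : ℕ} {s : Mon c} {t : Mon e} {S : Mon d}
    (h : s.labels.Disjoint t.labels)
    (hs : ∀ p ∈ s.leaves, p ≠ (a, d) → p.1 ∉ S.labels)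
    (ht : ∀ p ∈ t.leaves, p ≠ (a, d) → p.1 ∉ S.labels) :
    (s.graft a S).labels.Disjoint (t.graft a S).labels := by
  intro b h₁ h₂
  obtain ⟨u, hu⟩ := mem_labels.1 h₁
  obtain ⟨v, hv⟩ := mem_labels.1 h₂
  rw [mem_leaves_graft] at hu hv
  rcases hu with hu | hu <;> rcases hv with hv | hv
  · exact h (mem_labels.2 ⟨u, hu.1⟩) (mem_labels.2 ⟨v, hv.1⟩)
  · exact hs _ hu.1 hu.2 (mem_labels.2 ⟨v, hv.2⟩)
  · exact ht _ hv.1 hv.2 (mem_labels.2 ⟨u, hu.2⟩)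
  · exact h (mem_labels_of_mem hu.1) (mem_labels_of_mem hv.1)

theorem nodup_labels_graft {a : ℕ} {T : Mon c} {S : Mon d} (hT : T.labels.Nodup)
    (hS : S.labels.Nodup) (h : ∀ p ∈ T.leaves, p ≠ (a, d) → p.1 ∉ S.labels) :
    (T.graft a S).labels.Nodup := by
  induction T with
  | leaf c b =>
    by_cases h : d = c ∧ b = a
    · obtain ⟨rfl, rfl⟩ := h
      simpa
    · simp [graft_leaf, plug, dif_neg h]
  | i t ih => exact ih hT h
  | α s t ih₁ ih₂ | l s t ih₁ ih₂ | r s t ih₁ ih₂ =>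
    simp only [labels_α, labels_l, labels_r, List.nodup_append', leaves, List.mem_append] at hT h
    simp only [graft_α, graft_l, graft_r, labels_α, labels_l, labels_r, List.nodup_append']
    exact ⟨ih₁ hT.1 fun p hp => h p (.inl hp), ih₂ hT.2.1 fun p hp => h p (.inr hp),
      disjoint_labels_graft hT.2.2 (fun p hp => h p (.inl hp)) fun p hp => h p (.inr hp)⟩

theorem HasLeaves.graft {a : ℕ} {T : Mon c} {S : Mon d} {X Y : CSet} (hT : T.HasLeaves X)
    (hS : S.HasLeaves Y) (h : (a, d) ∈ X)
    (hd : Disjoint (CSet.labels (X.erase (a, d))) Y.labels) :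
    (T.graft a S).HasLeaves (X.erase (a, d) ∪ Y) := by
  obtain ⟨hT, rfl⟩ := hT
  obtain ⟨hS, rfl⟩ := hS
  refine ⟨nodup_labels_graft hT hS fun p hp hne hp' => ?_, leafSet_graft h⟩
  refine Set.disjoint_left.1 hd ⟨p.2, ?_⟩ (mem_labels_leafSet.2 hp')
  exact Finset.mem_erase.2 ⟨hne, mem_leafSet.2 hp⟩

theorem minLabel_graft (T : Mon c) (S : Mon d) : (T.graft S.minLabel S).minLabel = T.minLabel := by
  induction T with
  | leaf c b =>
    by_cases h : d = c ∧ b = S.minLabel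
    · obtain ⟨rfl, rfl⟩ := h
      simp [minLabel]
    · simp [graft_leaf, plug, dif_neg h]
  | i t ih => exact ih
  | α s t ih₁ ih₂ | l s t ih₁ ih₂ | r s t ih₁ ih₂ => simp [minLabel, ih₁, ih₂]

theorem IsShuffle.graft {T : Mon c} {S : Mon d} (hT : T.IsShuffle) (hS : S.IsShuffle) :
    (T.graft S.minLabel S).IsShuffle := by
  induction T with
  | leaf c b =>
    by_cases h : d = c ∧ b = S.minLabel
    · obtain ⟨rfl, rfl⟩ := h
      simpa
    · simp [graft_leaf, plug, dif_neg h, IsShuffle]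
  | i t ih => exact ih hT
  | α s t ih₁ ih₂ | l s t ih₁ ih₂ | r s t ih₁ ih₂ =>
    exact ⟨by
      change (s.graft _ S).minLabel < (t.graft _ S).minLabel
      simpa only [minLabel_graft] using hT.1, ih₁ hT.2.1, ih₂ hT.2.2⟩

end Graft

/-! #### Change of labels -/

section Relabel

@[simp] theorem relabel_leaf (φ : ℕ → ℕ) (a : ℕ) : (leaf c a).relabel φ = leaf c (φ a) := rfl
@[simp] theorem relabel_i (φ : ℕ → ℕ) (t : Mon .idl) : (i t).relabel φ = i (t.relabel φ) := rfl
@[simp] theorem relabel_α (φ : ℕ → ℕ) (s t : Mon .alg) :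
    (α s t).relabel φ = α (s.relabel φ) (t.relabel φ) := rfl
@[simp] theorem relabel_l (φ : ℕ → ℕ) (s : Mon .alg) (t : Mon .idl) :
    (l s t).relabel φ = l (s.relabel φ) (t.relabel φ) := rfl
@[simp] theorem relabel_r (φ : ℕ → ℕ) (s : Mon .idl) (t : Mon .alg) :
    (r s t).relabel φ = r (s.relabel φ) (t.relabel φ) := rfl

theorem leaves_relabel (φ : ℕ → ℕ) (T : Mon c) :
    (T.relabel φ).leaves = T.leaves.map (Prod.map φ id) := by
  induction T <;> simp_all [leaves]

theorem labels_relabel (φ : ℕ → ℕ) (T : Mon c) : (T.relabel φ).labels = T.labels.map φ := by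
  simp [labels, leaves_relabel, Function.comp_def]

theorem vertices_relabel (φ : ℕ → ℕ) (T : Mon c) : (T.relabel φ).vertices = T.vertices := by
  induction T <;> simp_all [vertices]

theorem HasLeaves.relabel {T : Mon c} {X : CSet} {φ : ℕ → ℕ} (h : T.HasLeaves X)
    (hφ : Set.InjOn φ X.labels) : (T.relabel φ).HasLeaves (X.image (Prod.map φ id)) := by
  obtain ⟨hT, rfl⟩ := h
  constructor
  · rw [labels_relabel]
    exact hT.map_on fun x hx y hy e =>
      hφ (mem_labels_leafSet.2 hx) (mem_labels_leafSet.2 hy) e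
  · ext p
    simp [leaves_relabel]

theorem minLabel_relabel {φ : ℕ → ℕ} {T : Mon c} (h : MonotoneOn φ {a | a ∈ T.labels}) :
    (T.relabel φ).minLabel = φ T.minLabel := by
  apply le_antisymm
  · apply minLabel_le
    rw [labels_relabel]
    exact List.mem_map_of_mem T.minLabel_mem
  · have := (T.relabel φ).minLabel_mem
    rw [labels_relabel, List.mem_map] at this
    obtain ⟨a, ha, e⟩ := this
    rw [← e]
    exact h T.minLabel_mem ha (minLabel_le ha)

theorem IsShuffle.relabel {φ : ℕ → ℕ} {T : Mon c} (hT : T.IsShuffle)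
    (h : StrictMonoOn φ {a | a ∈ T.labels}) : (T.relabel φ).IsShuffle := by
  induction T with
  | leaf c b => trivial
  | i t ih => exact ih hT h
  | α s t ih₁ ih₂ | l s t ih₁ ih₂ | r s t ih₁ ih₂ =>
    have h₁ : StrictMonoOn φ {a | a ∈ s.labels} := h.mono fun a ha => by simp_all
    have h₂ : StrictMonoOn φ {a | a ∈ t.labels} := h.mono fun a ha => by simp_all
    refine ⟨?_, ih₁ hT.2.1 h₁, ih₂ hT.2.2 h₂⟩
    change (s.relabel φ).minLabel < (t.relabel φ).minLabel
    rw [minLabel_relabel h₁.monotoneOn, minLabel_relabel h₂.monotoneOn]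
    exact h (by simp [minLabel_mem]) (by simp [minLabel_mem]) hT.1

end Relabel

/-! ### The shuffle representative of a non-planar tree -/

/-- The planar representation of a tree in which the smallest labels of the subtrees increase from
left to right at every vertex. -/
def toShuffle : {c : Colour} → Mon c → Mon c
  | _, .leaf c a => .leaf c a
  | _, .i t => .i t.toShuffle
  | _, .α s t => if s.minLabel < t.minLabel then .α s.toShuffle t.toShuffle
      else .α t.toShuffle s.toShuffle
  | _, .l s t => if s.minLabel < t.minLabel then .l s.toShuffle t.toShuffle
      else .r t.toShuffle s.toShuffle
  | _, .r s t => if s.minLabel < t.minLabel then .r s.toShuffle t.toShuffle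
      else .l t.toShuffle s.toShuffle

theorem same_toShuffle (T : Mon c) : Same T T.toShuffle := by
  induction T with
  | leaf c b => exact .refl _
  | i t ih => exact .congr_i ih
  | α s t ih₁ ih₂ =>
    rw [toShuffle]
    split_ifs
    exacts [.congr_α ih₁ ih₂, (Same.congr_α ih₁ ih₂).trans (.swap_α _ _)]
  | l s t ih₁ ih₂ =>
    rw [toShuffle]
    split_ifs
    exacts [.congr_l ih₁ ih₂, (Same.congr_l ih₁ ih₂).trans (Same.swap_r _ _).symm]
  | r s t ih₁ ih₂ =>
    rw [toShuffle]
    split_ifs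
    exacts [.congr_r ih₁ ih₂, (Same.congr_r ih₁ ih₂).trans (.swap_r _ _)]

theorem Same.leafSet_eq {T T' : Mon c} (h : Same T T') : T.leafSet = T'.leafSet :=
  List.toFinset_eq_of_perm _ _ h.leaves_perm

theorem Same.labels_perm {T T' : Mon c} (h : Same T T') : T.labels.Perm T'.labels :=
  h.leaves_perm.map _

theorem Same.minLabel_eq {T T' : Mon c} (h : Same T T') : T.minLabel = T'.minLabel :=
  minLabel_eq_of_leafSet_eq h.leafSet_eq

theorem isShuffle_toShuffle {T : Mon c} (h : T.labels.Nodup) : T.toShuffle.IsShuffle := by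
  induction T with
  | leaf c b => trivial
  | i t ih => exact ih h
  | α s t ih₁ ih₂ | l s t ih₁ ih₂ | r s t ih₁ ih₂ =>
    simp only [labels_α, labels_l, labels_r, List.nodup_append'] at h
    have hne := minLabel_ne h.2.2
    have e₁ := s.same_toShuffle.minLabel_eq
    have e₂ := t.same_toShuffle.minLabel_eq
    rw [toShuffle]
    split_ifs with hlt
    · exact ⟨by omega, ih₁ h.1, ih₂ h.2.1⟩
    · exact ⟨by omega, ih₂ h.2.1, ih₁ h.1⟩

theorem IsShuffle.toShuffle_eq {T : Mon c} (h : T.IsShuffle) : T.toShuffle = T := by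
  induction T with
  | leaf c b => rfl
  | i t ih => rw [toShuffle, ih h]
  | α s t ih₁ ih₂ | l s t ih₁ ih₂ | r s t ih₁ ih₂ =>
    rw [toShuffle, if_pos h.1, ih₁ h.2.1, ih₂ h.2.2]

theorem Same.toShuffle_eq {T T' : Mon c} (h : Same T T') (hT : T.labels.Nodup) :
    T.toShuffle = T'.toShuffle := by
  induction h with
  | refl T => rfl
  | symm h ih => exact (ih (h.labels_perm.nodup_iff.2 hT)).symm
  | trans h _ ih₁ ih₂ => exact (ih₁ hT).trans (ih₂ (h.labels_perm.nodup_iff.1 hT))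
  | swap_α s t | swap_r s t =>
    simp only [labels_α, labels_r, List.nodup_append'] at hT
    have := minLabel_ne hT.2.2
    rw [toShuffle, toShuffle]
    split_ifs
    all_goals first | rfl | omega
  | congr_i _ ih => rw [toShuffle, toShuffle, ih hT]
  | congr_α h₁ h₂ ih₁ ih₂ | congr_l h₁ h₂ ih₁ ih₂ | congr_r h₁ h₂ ih₁ ih₂ =>
    simp only [labels_α, labels_l, labels_r, List.nodup_append'] at hT
    rw [toShuffle, toShuffle, h₁.minLabel_eq, h₂.minLabel_eq, ih₁ hT.1, ih₂ hT.2.1]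

/-- A non-planar tree with distinct labels has only one planar representation by a shuffle tree. -/
theorem Same.eq_of_isShuffle {T T' : Mon c} (h : Same T T') (hT : T.labels.Nodup)
    (hs : T.IsShuffle) (hs' : T'.IsShuffle) : T = T' := by
  rw [← hs.toShuffle_eq, h.toShuffle_eq hT, hs'.toShuffle_eq]

theorem Same.vertices_eq {T T' : Mon c} (h : Same T T') : T.vertices = T'.vertices := by
  induction h <;> simp_all [vertices, add_comm]

end Mon

/-! ### The path-lexicographic ordering is a strict total order on shuffle trees -/

instance : Std.Trichotomous Gen.lt :=
  ⟨fun g h => by cases g <;> cases h <;> simp [Gen.lt, Gen.rank]⟩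

instance : Std.Asymm Gen.lt := ⟨fun _ _ h h' => lt_asymm (α := ℕ) h h'⟩

instance : IsTrans Gen Gen.lt := ⟨fun _ _ _ h h' => lt_trans (α := ℕ) h h'⟩

theorem lex_trans {β : Type*} {R : β → β → Prop} [IsTrans β R] {u v w : List β}
    (h : List.Lex R u v) (h' : List.Lex R v w) : List.Lex R u w := by
  induction h generalizing w with
  | nil => cases h' <;> exact .nil
  | cons h ih =>
    cases h' with
    | cons h' => exact .cons (ih h')
    | rel h' => exact .rel h'
  | rel h =>
    cases h' with
    | cons h' => exact .rel h
    | rel h' => exact .rel (_root_.trans h h')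

instance {β : Type*} (R : β → β → Prop) [IsTrans β R] : IsTrans (List β) (List.Shortlex R) where
  trans u v w h h' := by
    rw [List.shortlex_def] at *
    rcases h with h | h <;> rcases h' with h' | h'
    · exact .inl (h.trans h')
    · exact .inl (by omega)
    · exact .inl (by omega)
    · exact .inr ⟨h.1.trans h'.1, lex_trans h.2 h'.2⟩

theorem shortlex_cons (g : Gen) {u v : List Gen} (h : List.Shortlex Gen.lt u v) :
    List.Shortlex Gen.lt (g :: u) (g :: v) :=
  List.shortlex_cons_iff.2 h

theorem lex_map_cons (g : Gen) {U V : List (List Gen)} (h : List.Lex (List.Shortlex Gen.lt) U V) :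
    List.Lex (List.Shortlex Gen.lt) (U.map (g :: ·)) (V.map (g :: ·)) := by
  induction h with
  | nil => exact .nil
  | cons _ ih => exact .cons ih
  | rel h => exact .rel (shortlex_cons g h)

namespace Mon

variable {c : Colour}

theorem PathLexLT.trans {T T' T'' : Mon c} (h : T.PathLexLT T') (h' : T'.PathLexLT T'') :
    T.PathLexLT T'' := by
  rcases h with h | ⟨e, h⟩ <;> rcases h' with h' | ⟨e', h'⟩
  · exact .inl (h.trans h')
  · exact .inl (by omega)
  · exact .inl (by omega)
  · refine .inr ⟨e.trans e', ?_⟩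
    rcases h with h | ⟨e, h⟩ <;> rcases h' with h' | ⟨e', h'⟩
    · exact .inl (lex_trans h h')
    · exact .inl (e' ▸ h)
    · exact .inl (e ▸ h')
    · exact .inr ⟨e.trans e', lex_trans h' h⟩

/-- The leaves of a planar tree from left to right, each with its label and with the word `w`
followed by its path word. -/
def code (w : List Gen) : {c : Colour} → Mon c → List (List Gen × ℕ)
  | _, .leaf _ a => [(w, a)]
  | _, .i t => t.code (w ++ [.i])
  | _, .α s t => s.code (w ++ [.α]) ++ t.code (w ++ [.α])
  | _, .l s t => s.code (w ++ [.l]) ++ t.code (w ++ [.l])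
  | _, .r s t => s.code (w ++ [.r]) ++ t.code (w ++ [.r])

theorem code_eq_cons (w : List Gen) (T : Mon c) :
    ∃ v a L, T.code w = (w ++ v, a) :: L := by
  induction T generalizing w with
  | leaf c a => exact ⟨[], a, [], by simp [code]⟩
  | i t ih =>
    obtain ⟨v, a, L, h⟩ := ih (w ++ [.i])
    exact ⟨.i :: v, a, L, by simp [code, h]⟩
  | α s t ih _ =>
    obtain ⟨v, a, L, h⟩ := ih (w ++ [.α])
    exact ⟨.α :: v, a, L ++ t.code (w ++ [.α]), by simp [code, h]⟩
  | l s t ih _ =>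
    obtain ⟨v, a, L, h⟩ := ih (w ++ [.l])
    exact ⟨.l :: v, a, L ++ t.code (w ++ [.l]), by simp [code, h]⟩
  | r s t ih _ =>
    obtain ⟨v, a, L, h⟩ := ih (w ++ [.r])
    exact ⟨.r :: v, a, L ++ t.code (w ++ [.r]), by simp [code, h]⟩

theorem code_ne_of_ne {c' : Colour} {w : List Gen} {g g' : Gen} (hg : g ≠ g') (s : Mon c)
    (t : Mon c') (R R' : List (List Gen × ℕ)) :
    s.code (w ++ [g]) ++ R ≠ t.code (w ++ [g']) ++ R' := by
  obtain ⟨v, a, L, h⟩ := s.code_eq_cons (w ++ [g])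
  obtain ⟨v', a', L', h'⟩ := t.code_eq_cons (w ++ [g'])
  simp [h, h', hg]

theorem code_ne_cons {w : List Gen} {g : Gen} (s : Mon c) (a : ℕ) (R R' : List (List Gen × ℕ)) :
    s.code (w ++ [g]) ++ R ≠ (w, a) :: R' := by
  obtain ⟨v, a, L, h⟩ := s.code_eq_cons (w ++ [g])
  simp [h]

/-- Unique readability: a planar tree can be read off from any list that starts with its code. -/
theorem code_append_injective {w : List Gen} {T T' : Mon c} {R R' : List (List Gen × ℕ)}
    (h : T.code w ++ R = T'.code w ++ R') : T = T' ∧ R = R' := by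
  induction T generalizing w R R' with
  | leaf c a =>
    cases T' with
    | leaf c b => simpa [code] using h
    | _ => simp only [code, List.append_assoc] at h; exact absurd h.symm (code_ne_cons _ _ _ _)
  | i t ih =>
    cases T' with
    | leaf c b => exact absurd h (code_ne_cons _ _ _ _)
    | i t' => obtain ⟨rfl, rfl⟩ := ih h; exact ⟨rfl, rfl⟩
    | α s' t' =>
      simp only [code, List.append_assoc] at h
      exact absurd h (code_ne_of_ne (by simp) _ _ _ _)
  | α s t ih₁ ih₂ =>
    simp only [code, List.append_assoc] at h
    cases T' with
    | leaf c b => exact absurd h (code_ne_cons _ _ _ _)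
    | i t' => exact absurd h (code_ne_of_ne (by simp) _ _ _ _)
    | α s' t' =>
      simp only [code, List.append_assoc] at h
      obtain ⟨rfl, h'⟩ := ih₁ h
      obtain ⟨rfl, rfl⟩ := ih₂ h'
      exact ⟨rfl, rfl⟩
  | l s t ih₁ ih₂ =>
    simp only [code, List.append_assoc] at h
    cases T' with
    | leaf c b => exact absurd h (code_ne_cons _ _ _ _)
    | l s' t' =>
      simp only [code, List.append_assoc] at h
      obtain ⟨rfl, h'⟩ := ih₁ h
      obtain ⟨rfl, rfl⟩ := ih₂ h'
      exact ⟨rfl, rfl⟩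
    | r s' t' =>
      simp only [code, List.append_assoc] at h
      exact absurd h (code_ne_of_ne (by simp) _ _ _ _)
  | r s t ih₁ ih₂ =>
    simp only [code, List.append_assoc] at h
    cases T' with
    | leaf c b => exact absurd h (code_ne_cons _ _ _ _)
    | r s' t' =>
      simp only [code, List.append_assoc] at h
      obtain ⟨rfl, h'⟩ := ih₁ h
      obtain ⟨rfl, rfl⟩ := ih₂ h'
      exact ⟨rfl, rfl⟩
    | l s' t' =>
      simp only [code, List.append_assoc] at h
      exact absurd h (code_ne_of_ne (by simp) _ _ _ _)

theorem map_ite_append {β : Type*} {L L' : List ℕ} (h : L.Disjoint L') (f g : ℕ → β) :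
    (L ++ L').map (fun a => if a ∈ L then f a else g a) = L.map f ++ L'.map g := by
  rw [List.map_append]
  congr 1 <;> refine List.map_congr_left fun a ha => ?_
  · exact if_pos ha
  · exact if_neg fun ha' => h ha' ha

theorem code_eq_map {T : Mon c} (h : T.labels.Nodup) (w : List Gen) :
    T.code w = T.labels.map fun a => (w ++ T.path a, a) := by
  induction T generalizing w with
  | leaf c a => simp [code, path]
  | i t ih => simp [code, path, ih h]
  | α s t ih₁ ih₂ | l s t ih₁ ih₂ | r s t ih₁ ih₂ =>
    simp only [labels_α, labels_l, labels_r, List.nodup_append'] at h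
    simp only [code, path, ih₁ h.1, ih₂ h.2.1, labels_α, labels_l, labels_r, List.append_assoc,
      List.cons_append, List.nil_append]
    rw [← map_ite_append h.2.2]
    refine List.map_congr_left fun a _ => ?_
    split_ifs <;> rfl

theorem eq_of_pathVector_eq {T T' : Mon c} (h : T.labels.Nodup)
    (hl : T.labels = T'.labels) (hp : T.pathVector = T'.pathVector) : T = T' := by
  have : T.code [] ++ [] = T'.code [] ++ [] := by
    rw [code_eq_map h, code_eq_map (hl ▸ h), ← hl]
    unfold pathVector at hp
    rw [← hl] at hp
    congr 1
    refine List.map_congr_left fun a ha => ?_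
    rw [List.map_inj_left.1 hp a (List.mem_insertionSort _ |>.2 ha)]
  exact (code_append_injective this).1

theorem pathLexLT_trichotomous {T T' : Mon c} (h : T.labels.Nodup) (h' : T'.labels.Nodup)
    (e : T.leafSet = T'.leafSet) : T.PathLexLT T' ∨ T = T' ∨ T'.PathLexLT T := by
  have hlen : T.leaves.length = T'.leaves.length := (leaves_perm_of_leafSet_eq h h' e).length_eq
  rcases trichotomous_of (List.Lex (List.Shortlex Gen.lt)) T.pathVector T'.pathVector with
    hp | hp | hp
  · exact .inl (.inr ⟨hlen, .inl hp⟩)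
  · rcases trichotomous_of (List.Lex (· < ·)) T.labels T'.labels with hl | hl | hl
    · exact .inr (.inr (.inr ⟨hlen.symm, .inr ⟨hp.symm, hl⟩⟩))
    · exact .inr (.inl (eq_of_pathVector_eq h hl hp))
    · exact .inl (.inr ⟨hlen, .inr ⟨hp, hl⟩⟩)
  · exact .inr (.inr (.inr ⟨hlen.symm, .inl hp⟩))

/-- A nonempty finite set of trees with the same leaves has a largest element. -/
theorem exists_max_pathLexLT (F : Finset (Mon c)) (hF : F.Nonempty) {X : CSet}
    (h : ∀ T ∈ F, T.HasLeaves X) : ∃ T ∈ F, ∀ T' ∈ F, T' ≠ T → T'.PathLexLT T := by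
  classical
  induction hF using Finset.Nonempty.cons_induction with
  | singleton T => exact ⟨T, by simp, by simp⟩
  | cons T F hT hF ih =>
    obtain ⟨M, hM, hmax⟩ := ih fun S hS => h S (Finset.mem_cons_of_mem hS)
    have hX := h T (Finset.mem_cons_self _ _)
    have hX' := h M (Finset.mem_cons_of_mem hM)
    rcases pathLexLT_trichotomous hX.1 hX'.1 (hX.2.trans hX'.2.symm) with hlt | rfl | hlt
    · refine ⟨M, Finset.mem_cons_of_mem hM, fun S hS hne => ?_⟩
      rcases Finset.mem_cons.1 hS with rfl | hS
      exacts [hlt, hmax S hS hne]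
    · exact absurd hM hT
    · refine ⟨T, Finset.mem_cons_self _ _, fun S hS hne => ?_⟩
      rcases Finset.mem_cons.1 hS with rfl | hS
      · exact absurd rfl hne
      · by_cases hSM : S = M
        · exact hSM ▸ hlt
        · exact (hmax S hS hSM).trans hlt

/-! ### Normal trees -/

/-- The trees that are not divisible by the leading term of a relation: right combs in which the
left input of every binary vertex is a leaf, or, at a vertex `α`, the generator `i` on a leaf. -/
inductive Normal : {c : Colour} → Mon c → Prop
  | leaf (c : Colour) (a : ℕ) : Normal (leaf c a)
  | i_leaf (a : ℕ) : Normal (i (leaf .idl a))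
  | α_leaf (a : ℕ) {t : Mon .alg} : Normal t → Normal (α (leaf .alg a) t)
  | α_i_leaf (a : ℕ) {t : Mon .alg} : Normal t → Normal (α (i (leaf .idl a)) t)
  | l_leaf (a : ℕ) {t : Mon .idl} : Normal t → Normal (l (leaf .alg a) t)
  | r_leaf (a : ℕ) {t : Mon .alg} : Normal t → Normal (r (leaf .idl a) t)

theorem IsShuffle.insertionSort_labels {T : Mon c} (h : T.IsShuffle) :
    ∃ L, T.labels = T.minLabel :: L ∧
      T.labels.insertionSort (· ≤ ·) = T.minLabel :: L.insertionSort (· ≤ ·) := by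
  obtain ⟨L, hL⟩ := h.labels_eq_cons
  refine ⟨L, hL, ?_⟩
  rw [hL, List.insertionSort_cons_of_forall_rel]
  exact fun b hb => minLabel_le (hL ▸ List.mem_cons_of_mem _ hb)

theorem insertionSort_labels_eq {c' : Colour} {T : Mon c} {T' : Mon c'} (h : T.labels.Nodup)
    (h' : T'.labels.Nodup) (e : T.leafSet = T'.leafSet) :
    T.labels.insertionSort (· ≤ ·) = T'.labels.insertionSort (· ≤ ·) := by
  refine List.Perm.eq_of_pairwise (le := (· ≤ ·)) (fun a b _ _ h h' => le_antisymm h h')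
    (List.pairwise_insertionSort _ _) (List.pairwise_insertionSort _ _) ?_
  exact (List.perm_insertionSort _ _).trans
    ((labels_perm_of_leafSet_eq h h' e).trans (List.perm_insertionSort _ _).symm)

/-- Two trees with the same leaves are compared first at the leaf with the smallest label. -/
theorem lex_pathVector_of_shortlex {N T : Mon c} (hN : N.IsShuffle) (hN' : N.labels.Nodup)
    (hT : T.labels.Nodup) (e : T.leafSet = N.leafSet)
    (h : List.Shortlex Gen.lt (N.path N.minLabel) (T.path N.minLabel)) :
    List.Lex (List.Shortlex Gen.lt) N.pathVector T.pathVector := by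
  obtain ⟨L, -, hL⟩ := hN.insertionSort_labels
  rw [pathVector, pathVector, insertionSort_labels_eq hT hN' e, hL]
  exact .rel h

theorem path_ne_nil_or (T : Mon c) (a : ℕ) : (∃ b, T = leaf c b) ∨ 0 < (T.path a).length := by
  cases T <;> simp [path]

/-- The path vector of a tree whose root `g` has a one-leaf tree `s` at its left input. -/
theorem pathVector_binary {c' c'' : Colour} {s : Mon c'} {t : Mon c''} {a : ℕ} {g : Gen}
    (T : Mon c) (hs : s.labels = [a]) (hT : T.labels = a :: t.labels) (hlt : a < t.minLabel)
    (hp : ∀ b, T.path b = g :: if b ∈ s.labels then s.path b else t.path b) :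
    T.pathVector = (g :: s.path a) :: t.pathVector.map (g :: ·) := by
  have hle : ∀ b ∈ t.labels, a < b := fun b hb => hlt.trans_le (minLabel_le hb)
  rw [pathVector, hT, List.insertionSort_cons_of_forall_rel _ (fun b hb => (hle b hb).le),
    List.map_cons, hp, if_pos (by simp [hs]), pathVector, List.map_map]
  congr 1
  refine List.map_congr_left fun b hb => ?_
  have := hle b ((List.mem_insertionSort _).1 hb)
  simp [hp, hs, this.ne']

theorem union_leafSet_ne_singleton {c' : Colour} {s : Mon c} {t : Mon c'}
    (h : s.labels.Disjoint t.labels) (p : ℕ × Colour) : s.leafSet ∪ t.leafSet ≠ {p} := by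
  intro e
  have key : ∀ a, a ∈ s.labels ∨ a ∈ t.labels → a = p.1 := fun a ha => by
    have : a ∈ CSet.labels (s.leafSet ∪ t.leafSet) := by
      rcases ha with ha | ha <;> obtain ⟨v, hv⟩ := mem_labels.1 ha
      exacts [⟨v, Finset.mem_union_left _ (mem_leafSet.2 hv)⟩,
        ⟨v, Finset.mem_union_right _ (mem_leafSet.2 hv)⟩]
    rw [e] at this
    obtain ⟨v, hv⟩ := this
    rw [← Finset.mem_singleton.1 hv]
  exact minLabel_ne h ((key _ (.inl s.minLabel_mem)).trans (key _ (.inr t.minLabel_mem)).symm)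

theorem leafSet_eq_of_singleton_union {c' : Colour} {s : Mon c} {t : Mon c'} {p : ℕ × Colour}
    (hs : p.1 ∉ s.labels) (ht : p.1 ∉ t.labels) (e : {p} ∪ s.leafSet = {p} ∪ t.leafSet) :
    s.leafSet = t.leafSet := by
  have hs' : p ∉ s.leafSet := fun h => hs (mem_labels_of_mem (mem_leafSet.1 h))
  have ht' : p ∉ t.leafSet := fun h => ht (mem_labels_of_mem (mem_leafSet.1 h))
  rw [← Finset.insert_eq, ← Finset.insert_eq] at e
  rw [← Finset.erase_insert hs', e, Finset.erase_insert ht']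

theorem mem_leaves_iff_of_leafSet_eq {c' : Colour} {s : Mon c} {t : Mon c'}
    (e : s.leafSet = t.leafSet) {p : ℕ × Colour} : p ∈ s.leaves ↔ p ∈ t.leaves := by
  rw [← mem_leafSet, e, mem_leafSet]

theorem shortlex_singleton {g h : Gen} {w : List Gen} (H : 0 < w.length ∨ Gen.lt g h) :
    List.Shortlex Gen.lt [g] (h :: w) := by
  rcases w with _ | ⟨x, w⟩
  · simpa using H
  · exact .of_length_lt (by simp)

/-- Two trees with the same root `g` and the same one-leaf tree `s` at its left input compare as the
trees at the right input. -/
theorem lex_binary {c' c'' : Colour} {s : Mon c'} {t t' : Mon c''} {a : ℕ} {g : Gen}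
    {T T' : Mon c} (hs : s.labels = [a]) (hT : T.labels = s.labels ++ t.labels)
    (hT' : T'.labels = s.labels ++ t'.labels) (hlt : s.minLabel < t.minLabel)
    (hlt' : s.minLabel < t'.minLabel)
    (hp : ∀ b, T.path b = g :: if b ∈ s.labels then s.path b else t.path b)
    (hp' : ∀ b, T'.path b = g :: if b ∈ s.labels then s.path b else t'.path b)
    (h : List.Lex (List.Shortlex Gen.lt) t.pathVector t'.pathVector) :
    List.Lex (List.Shortlex Gen.lt) T.pathVector T'.pathVector := by
  obtain rfl : s.minLabel = a := by simpa [hs] using s.minLabel_mem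
  rw [pathVector_binary T hs (by simpa [hs] using hT) hlt hp,
    pathVector_binary T' hs (by simpa [hs] using hT') hlt' hp']
  exact .cons (lex_map_cons g h)

/-- A normal tree is the smallest tree with its leaves, already with respect to the vectors of path
words. -/
theorem Normal.eq_or_lex {N T : Mon c} (hN : Normal N) (hs : N.IsShuffle) (hd : N.labels.Nodup)
    (hT : T.IsShuffle) (hTd : T.labels.Nodup) (e : T.leafSet = N.leafSet) :
    T = N ∨ List.Lex (List.Shortlex Gen.lt) N.pathVector T.pathVector := by
  induction hN with
  | leaf c a =>
    have hfirst := lex_pathVector_of_shortlex hs hd hTd e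
    rcases T.path_ne_nil_or a with ⟨b, rfl⟩ | hpos
    · simp only [leafSet_leaf, Finset.singleton_inj, Prod.mk.injEq, and_true] at e
      exact .inl (by rw [e])
    · exact .inr (hfirst (.of_length_lt (by simpa [path, minLabel] using hpos)))
  | i_leaf a =>
    have hfirst := lex_pathVector_of_shortlex hs hd hTd e
    cases T with
    | leaf _ b => simp at e
    | i t =>
      rcases t.path_ne_nil_or a with ⟨b, rfl⟩ | hpos
      · simp at e
        exact .inl (by rw [e])
      · exact .inr (hfirst (shortlex_singleton (.inl (by simpa [minLabel] using hpos))))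
    | α s t =>
      simp only [labels_α, List.nodup_append'] at hTd
      rw [leafSet_α, leafSet_i, leafSet_leaf] at e
      exact absurd e (union_leafSet_ne_singleton hTd.2.2 _)
  | @α_leaf a N hN ih =>
    have hmin := minLabel_eq_of_leafSet_eq e
    have hfirst := lex_pathVector_of_shortlex hs hd hTd e
    simp only [labels_α, labels_leaf, List.nodup_append', List.singleton_disjoint] at hd
    have hmN : (α (.leaf .alg a) N).minLabel = a := by simpa [minLabel] using hs.1.le
    rw [hmN] at hfirst hmin
    cases T with
    | leaf _ b =>
      rw [leafSet_α, leafSet_leaf] at e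
      exact absurd e.symm (union_leafSet_ne_singleton (by simpa using hd.2.2) _)
    | i t => exact .inr (hfirst (by simp [path, shortlex_singleton, Gen.lt, Gen.rank]))
    | α s t =>
      simp only [labels_α, List.nodup_append'] at hTd
      have hms : s.minLabel = a := by simpa [minLabel, hT.1.le] using hmin
      have has : a ∈ s.labels := hms ▸ s.minLabel_mem
      rcases s.path_ne_nil_or a with ⟨b, rfl⟩ | hpos
      · obtain rfl : b = a := hms
        simp only [leafSet_α, leafSet_leaf] at e
        have e' := leafSet_eq_of_singleton_union (fun h => hTd.2.2 (by simp) h) hd.2.2 e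
        rcases ih hs.2.2 hd.2.1 hT.2.2 hTd.2.1 e' with h | h
        · exact .inl (by rw [h])
        · exact .inr (lex_binary (s := .leaf .alg b) rfl rfl rfl hs.1 hT.1 (fun _ => rfl)
            (fun _ => rfl) h)
      · refine .inr (hfirst ?_)
        simpa [path, has] using shortlex_singleton (.inl hpos)
  | @l_leaf a N hN ih =>
    have hmin := minLabel_eq_of_leafSet_eq e
    have hfirst := lex_pathVector_of_shortlex hs hd hTd e
    simp only [labels_l, labels_leaf, List.nodup_append', List.singleton_disjoint] at hd
    have hmN : (l (.leaf .alg a) N).minLabel = a := by simpa [minLabel] using hs.1.le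
    rw [hmN] at hfirst hmin
    cases T with
    | leaf _ b =>
      rw [leafSet_l, leafSet_leaf] at e
      exact absurd e.symm (union_leafSet_ne_singleton (by simpa using hd.2.2) _)
    | r s t => exact .inr (hfirst (by simp [path, shortlex_singleton, Gen.lt, Gen.rank]))
    | l s t =>
      simp only [labels_l, List.nodup_append'] at hTd
      have hms : s.minLabel = a := by simpa [minLabel, hT.1.le] using hmin
      have has : a ∈ s.labels := hms ▸ s.minLabel_mem
      rcases s.path_ne_nil_or a with ⟨b, rfl⟩ | hpos
      · obtain rfl : b = a := hms
        simp only [leafSet_l, leafSet_leaf] at e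
        have e' := leafSet_eq_of_singleton_union (fun h => hTd.2.2 (by simp) h) hd.2.2 e
        rcases ih hs.2.2 hd.2.1 hT.2.2 hTd.2.1 e' with h | h
        · exact .inl (by rw [h])
        · exact .inr (lex_binary (s := .leaf .alg b) rfl rfl rfl hs.1 hT.1 (fun _ => rfl)
            (fun _ => rfl) h)
      · refine .inr (hfirst ?_)
        simpa [path, has] using shortlex_singleton (.inl hpos)
  | @r_leaf a N hN ih =>
    have hmin := minLabel_eq_of_leafSet_eq e
    have hfirst := lex_pathVector_of_shortlex hs hd hTd e
    have hmem : (a, Colour.idl) ∈ T.leaves := (mem_leaves_iff_of_leafSet_eq e).2 (by simp [leaves])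
    have hcol : (a, Colour.alg) ∉ T.leaves := fun h => by
      simpa using eq_of_mem_leaves hTd hmem h
    simp only [labels_r, labels_leaf, List.nodup_append', List.singleton_disjoint] at hd
    have hmN : (r (.leaf .idl a) N).minLabel = a := by simpa [minLabel] using hs.1.le
    rw [hmN] at hfirst hmin
    cases T with
    | leaf _ b =>
      rw [leafSet_r, leafSet_leaf] at e
      exact absurd e.symm (union_leafSet_ne_singleton (by simpa using hd.2.2) _)
    | l s t =>
      have hms : s.minLabel = a := by simpa [minLabel, hT.1.le] using hmin
      have has : a ∈ s.labels := hms ▸ s.minLabel_mem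
      rcases s.path_ne_nil_or a with ⟨b, rfl⟩ | hpos
      · obtain rfl : b = a := hms
        exact absurd (by simp [leaves]) hcol
      · refine .inr (hfirst ?_)
        simpa [path, has] using shortlex_singleton (.inl hpos)
    | r s t =>
      simp only [labels_r, List.nodup_append'] at hTd
      have hms : s.minLabel = a := by simpa [minLabel, hT.1.le] using hmin
      have has : a ∈ s.labels := hms ▸ s.minLabel_mem
      rcases s.path_ne_nil_or a with ⟨b, rfl⟩ | hpos
      · obtain rfl : b = a := hms
        simp only [leafSet_r, leafSet_leaf] at e
        have e' := leafSet_eq_of_singleton_union (fun h => hTd.2.2 (by simp) h) hd.2.2 e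
        rcases ih hs.2.2 hd.2.1 hT.2.2 hTd.2.1 e' with h | h
        · exact .inl (by rw [h])
        · exact .inr (lex_binary (s := .leaf .idl b) rfl rfl rfl hs.1 hT.1 (fun _ => rfl)
            (fun _ => rfl) h)
      · refine .inr (hfirst ?_)
        simpa [path, has] using shortlex_singleton (.inl hpos)
  | @α_i_leaf a N hN ih =>
    have hmin := minLabel_eq_of_leafSet_eq e
    have hfirst := lex_pathVector_of_shortlex hs hd hTd e
    have hmem : (a, Colour.idl) ∈ T.leaves := (mem_leaves_iff_of_leafSet_eq e).2 (by simp [leaves])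
    have hcol : (a, Colour.alg) ∉ T.leaves := fun h => by
      simpa using eq_of_mem_leaves hTd hmem h
    simp only [labels_α, labels_i, labels_leaf, List.nodup_append', List.singleton_disjoint] at hd
    have hmN : (α (.i (.leaf .idl a)) N).minLabel = a := by simpa [minLabel] using hs.1.le
    rw [hmN] at hfirst hmin
    have hpN : path a (α (.i (.leaf .idl a)) N) = [.α, .i] := by simp [path]
    rw [hpN] at hfirst
    cases T with
    | leaf _ b =>
      rw [leafSet_α, leafSet_i, leafSet_leaf] at e
      exact absurd e.symm (union_leafSet_ne_singleton (by simpa using hd.2.2) _)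
    -- The path word of `a` is longer than `αi`, or it has two letters and starts with `i > α`.
    | i t =>
      rcases t.path_ne_nil_or a with ⟨b, rfl⟩ | hpos
      · rw [leafSet_i, leafSet_α, leafSet_i, leafSet_leaf, leafSet_leaf] at e
        exact absurd e.symm (union_leafSet_ne_singleton
          (s := Mon.leaf .idl a) (t := N) (by simpa using hd.2.2) _)
      · refine .inr (hfirst ?_)
        rw [List.shortlex_def, path]
        by_cases h1 : 2 < (i t |>.path a).length
        · exact .inl h1
        · refine .inr ⟨?_, .rel (by simp [Gen.lt, Gen.rank])⟩
          simp only [path, List.length_cons] at h1 ⊢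
          simp
          omega
    | α s t =>
      simp only [labels_α, List.nodup_append'] at hTd
      have hms : s.minLabel = a := by simpa [minLabel, hT.1.le] using hmin
      have has : a ∈ s.labels := hms ▸ s.minLabel_mem
      have hpT : path a (α s t) = .α :: s.path a := by simp [path, has]
      rw [hpT] at hfirst
      cases s with
      | leaf _ b =>
        obtain rfl : b = a := hms
        exact absurd (by simp [leaves]) hcol
      | i s =>
        rcases s.path_ne_nil_or a with ⟨b, rfl⟩ | hpos
        · obtain rfl : b = a := hms
          simp only [leafSet_α, leafSet_i, leafSet_leaf] at e
          have e' := leafSet_eq_of_singleton_union (fun h => hTd.2.2 (by simp) h)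
            (by simpa using hd.2.2) e
          rcases ih hs.2.2 hd.2.1 hT.2.2 hTd.2.1 e' with h | h
          · exact .inl (by rw [h])
          · exact .inr (lex_binary (s := .i (.leaf .idl b)) rfl rfl rfl hs.1 hT.1 (fun _ => rfl)
              (fun _ => rfl) h)
        · exact .inr (hfirst (.of_length_lt (by simpa [path] using hpos)))
      -- The word `αα` would be smaller than `αi`, but it needs a leaf `a` of the first colour.
      | α s₁ s₂ =>
        refine .inr (hfirst (.of_length_lt ?_))
        have hms' : s₁.minLabel = a := by simpa [minLabel, hT.2.1.1.le] using hms
        have has' : a ∈ s₁.labels := hms' ▸ s₁.minLabel_mem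
        rcases s₁.path_ne_nil_or a with ⟨b, rfl⟩ | hpos
        · obtain rfl : b = a := hms'
          exact absurd (by simp [leaves]) hcol
        · simpa [path, has'] using hpos

theorem Normal.eq_or_pathLexLT {N T : Mon c} (hN : Normal N) (hs : N.IsShuffle)
    (hd : N.labels.Nodup) (hT : T.IsShuffle) (hTd : T.labels.Nodup) (e : T.leafSet = N.leafSet) :
    T = N ∨ N.PathLexLT T :=
  (hN.eq_or_lex hs hd hT hTd e).imp_right fun h =>
    .inr ⟨(leaves_perm_of_leafSet_eq hTd hd e).length_eq.symm, .inl h⟩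

/-- There is only one normal shuffle tree with given leaves and given colour of the output. -/
theorem Normal.unique {N N' : Mon c} (hN : Normal N) (hN' : Normal N') (hs : N.IsShuffle)
    (hs' : N'.IsShuffle) (hd : N.labels.Nodup) (hd' : N'.labels.Nodup)
    (e : N.leafSet = N'.leafSet) : N = N' := by
  rcases hN.eq_or_lex hs hd hs' hd' e.symm with h | h
  · exact h.symm
  · rcases hN'.eq_or_lex hs' hd' hs hd e with h' | h'
    · exact h'
    · exact absurd h' (asymm_of _ h)

end Mon

/-! ### The quadratic relations as rewriting rules -/

namespace Mon

/-- The rewriting rules given by the relations: `Rule S S'` says that a relation identifies the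
shuffle trees `S > S'`, whose leaves are labelled `1, 2` or `1, 2, 3`, and that `S'` is the normal
tree with these leaves. -/
inductive Rule : {c : Colour} → Mon c → Mon c → Prop
  | α_α₁₂ : Rule (α (α (leaf _ 1) (leaf _ 2)) (leaf _ 3)) (α (leaf _ 1) (α (leaf _ 2) (leaf _ 3)))
  | α_α₁₃ : Rule (α (α (leaf _ 1) (leaf _ 3)) (leaf _ 2)) (α (leaf _ 1) (α (leaf _ 2) (leaf _ 3)))
  | i_r : Rule (i (r (leaf _ 1) (leaf _ 2))) (α (i (leaf _ 1)) (leaf _ 2))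
  | i_l : Rule (i (l (leaf _ 1) (leaf _ 2))) (α (leaf _ 1) (i (leaf _ 2)))
  | l_i : Rule (l (i (leaf _ 1)) (leaf _ 2)) (r (leaf _ 1) (i (leaf _ 2)))
  | l_α₁₂ : Rule (l (α (leaf _ 1) (leaf _ 2)) (leaf _ 3)) (l (leaf _ 1) (l (leaf _ 2) (leaf _ 3)))
  | l_α₁₃ : Rule (l (α (leaf _ 1) (leaf _ 3)) (leaf _ 2)) (l (leaf _ 1) (r (leaf _ 2) (leaf _ 3)))
  | r_l₁₂ : Rule (r (l (leaf _ 1) (leaf _ 2)) (leaf _ 3)) (l (leaf _ 1) (r (leaf _ 2) (leaf _ 3)))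
  | r_l₁₃ : Rule (r (l (leaf _ 1) (leaf _ 3)) (leaf _ 2)) (l (leaf _ 1) (l (leaf _ 2) (leaf _ 3)))
  | r_r₁₂ : Rule (r (r (leaf _ 1) (leaf _ 2)) (leaf _ 3)) (r (leaf _ 1) (α (leaf _ 2) (leaf _ 3)))
  | r_r₁₃ : Rule (r (r (leaf _ 1) (leaf _ 3)) (leaf _ 2)) (r (leaf _ 1) (α (leaf _ 2) (leaf _ 3)))

namespace Rule

variable {c : Colour} {S S' : Mon c}

theorem isShuffle_left (h : Rule S S') : S.IsShuffle := by
  cases h <;> simp [IsShuffle, minLabel]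

theorem isShuffle_right (h : Rule S S') : S'.IsShuffle := by
  cases h <;> simp [IsShuffle, minLabel]

theorem nodup_left (h : Rule S S') : S.labels.Nodup := by cases h <;> simp

theorem nodup_right (h : Rule S S') : S'.labels.Nodup := by cases h <;> simp

theorem leafSet_eq (h : Rule S S') : S'.leafSet = S.leafSet := by
  cases h <;> simp only [leafSet_α, leafSet_l, leafSet_r, leafSet_i, leafSet_leaf] <;> decide

theorem pathLexLT (h : Rule S S') : S'.PathLexLT S := by
  refine .inr ⟨by cases h <;> rfl, .inl ?_⟩
  cases h
  case i_r => exact .rel (.of_lex rfl (.rel (by simp [Gen.lt, Gen.rank])))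
  all_goals exact .rel (.of_length_lt (by simp [path]))

theorem ne (h : Rule S S') : S ≠ S' := by
  cases h <;> simp

end Rule

end Mon

section

variable (k : Type*) [Field k] {c : Colour}

open Mon

theorem image_Icc_of_forall {n : ℕ} {σ : Equiv.Perm ℕ} (h : ∀ x ∈ Set.Icc 1 n, σ x ∈ Set.Icc 1 n) :
    σ '' Set.Icc 1 n = Set.Icc 1 n :=
  Set.eq_of_subset_of_ncard_le (Set.image_subset_iff.2 h)
    (Set.ncard_image_of_injective _ σ.injective).ge (Set.finite_Icc 1 n)

theorem forgetPlanar_single (T : Mon c) :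
    forgetPlanar k c (Finsupp.single T 1) = mon k T :=
  Finsupp.mapDomain_single

theorem mapDomain_relabel_mon_sub (φ : ℕ → ℕ) (A B : Mon c) :
    (mon k A - mon k B).mapDomain (SMon.relabel φ) = mon k (A.relabel φ) - mon k (B.relabel φ) := by
  rw [← Finsupp.lmapDomain_apply k k, map_sub, Finsupp.lmapDomain_apply, Finsupp.lmapDomain_apply,
    mon, mon, Finsupp.mapDomain_single, Finsupp.mapDomain_single]
  rfl

theorem mon_eq_of_same {T T' : Mon c} (h : Same T T') : mon k T = mon k T' :=
  congrArg (Finsupp.single · 1) (Quotient.sound h)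

theorem single_mem_freeSh {T : Mon c} (hT : T.IsShuffle) (hd : T.labels.Nodup) {X : CSet}
    (e : T.leafSet = X) : Finsupp.single T 1 ∈ FreeSh k X c :=
  Finsupp.single_mem_supported k 1 ⟨hT, hd, e⟩

theorem sub_mem_shRelations {n : ℕ} {A B S S' : Mon c} (h : DefRel k n c (mon k A - mon k B))
    (σ : Equiv.Perm ℕ) (hσ : ∀ x ∈ Set.Icc 1 n, σ x ∈ Set.Icc 1 n)
    (hS : S.IsShuffle) (hS' : S'.IsShuffle) (hd : S.labels.Nodup) (hd' : S'.labels.Nodup)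
    (e : S'.leafSet = S.leafSet) (hA : Same S (A.relabel σ)) (hB : Same S' (B.relabel σ)) :
    Finsupp.single S 1 - Finsupp.single S' 1 ∈ shRelations k c := by
  refine ⟨⟨S.leafSet, Submodule.sub_mem _ (single_mem_freeSh k hS hd rfl)
    (single_mem_freeSh k hS' hd' e)⟩, n, _, h, σ, image_Icc_of_forall hσ, ?_⟩
  rw [map_sub, forgetPlanar_single, forgetPlanar_single, mapDomain_relabel_mon_sub,
    mon_eq_of_same k hA, mon_eq_of_same k hB]

open Equiv in
/-- Every rewriting rule is, up to sign, in the orbit of a defining relation. -/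
theorem Mon.Rule.mem_shRelations {S S' : Mon c} (h : Rule S S') :
    Finsupp.single S 1 - Finsupp.single S' 1 ∈ shRelations k c ∨
      Finsupp.single S' 1 - Finsupp.single S 1 ∈ shRelations k c := by
  have pos {n : ℕ} {A B : Mon c} (H : DefRel k n c (mon k A - mon k B))
      (σ : Perm ℕ) (hσ : ∀ x ∈ Set.Icc 1 n, σ x ∈ Set.Icc 1 n)
      (hA : Same S (A.relabel σ)) (hB : Same S' (B.relabel σ)) :
      Finsupp.single S 1 - Finsupp.single S' 1 ∈ shRelations k c :=
    sub_mem_shRelations k H σ hσ h.isShuffle_left h.isShuffle_right h.nodup_left h.nodup_right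
      h.leafSet_eq hA hB
  have neg {n : ℕ} {A B : Mon c} (H : DefRel k n c (mon k A - mon k B))
      (σ : Perm ℕ) (hσ : ∀ x ∈ Set.Icc 1 n, σ x ∈ Set.Icc 1 n)
      (hA : Same S' (A.relabel σ)) (hB : Same S (B.relabel σ)) :
      Finsupp.single S' 1 - Finsupp.single S 1 ∈ shRelations k c :=
    sub_mem_shRelations k H σ hσ h.isShuffle_right h.isShuffle_left h.nodup_right h.nodup_left
      h.leafSet_eq.symm hA hB
  have icc2 (σ : Perm ℕ) (h : σ 1 ∈ Set.Icc 1 2 ∧ σ 2 ∈ Set.Icc 1 2) :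
      ∀ x ∈ Set.Icc 1 2, σ x ∈ Set.Icc 1 2 := by
    rintro x ⟨h₁, h₂⟩
    interval_cases x
    exacts [h.1, h.2]
  have icc3 (σ : Perm ℕ) (h : σ 1 ∈ Set.Icc 1 3 ∧ σ 2 ∈ Set.Icc 1 3 ∧ σ 3 ∈ Set.Icc 1 3) :
      ∀ x ∈ Set.Icc 1 3, σ x ∈ Set.Icc 1 3 := by
    rintro x ⟨h₁, h₂⟩
    interval_cases x
    exacts [h.1, h.2.1, h.2.2]
  cases h with
  | α_α₁₂ =>
    exact .inl (pos .com₂ (swap 2 3) (icc3 _ (by decide)) (.refl _)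
      (.congr_α (.refl _) (.swap_α _ _)))
  | α_α₁₃ => exact .inl (pos .com₂ 1 (icc3 _ (by decide)) (.refl _) (.refl _))
  | i_r => exact .inr (neg .hom 1 (icc2 _ (by decide)) (.refl _) (.refl _))
  | i_l =>
    exact .inr (neg .hom (swap 1 2) (icc2 _ (by decide)) (.swap_α _ _)
      (.congr_i (Same.swap_r _ _).symm))
  | l_i => exact .inr (neg .sym 1 (icc2 _ (by decide)) (.refl _) (Same.swap_r _ _).symm)
  | r_r₁₂ =>
    exact .inl (pos .act₂ (swap 2 3) (icc3 _ (by decide)) (.refl _)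
      (.congr_r (.refl _) (.swap_α _ _)))
  | r_r₁₃ => exact .inl (pos .act₂ 1 (icc3 _ (by decide)) (.refl _) (.refl _))
  | r_l₁₂ =>
    exact .inl (pos .act₁ (swap 1 2) (icc3 _ (by decide)) (.congr_r (Same.swap_r _ _).symm (.refl _))
      (Same.swap_r _ _).symm)
  | r_l₁₃ =>
    exact .inl (pos .act₁ (swap 1 2 * swap 1 3) (icc3 _ (by decide))
      (.congr_r (Same.swap_r _ _).symm (.refl _))
      ((Same.swap_r _ _).trans (.congr_l (.refl _) (.swap_r _ _))).symm)
  | l_α₁₂ =>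
    exact .inr (neg .act₂ (swap 1 2 * swap 1 3) (icc3 _ (by decide))
      ((Same.swap_r _ _).trans (.congr_l (.refl _) (.swap_r _ _))).symm
      (Same.swap_r _ _).symm)
  | l_α₁₃ =>
    exact .inr (neg .act₂ (swap 1 2) (icc3 _ (by decide)) (Same.swap_r _ _).symm
      (Same.swap_r _ _).symm)

end

/-! ### Congruence of shuffle trees modulo the shuffle ideal -/

section

variable {k : Type*} [Field k] {c d : Colour}

open Mon

variable (k) in
/-- Two shuffle trees with the same leaves are congruent if their difference lies in the ideal of the
free shuffle operad that is generated by the quadratic relations. -/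
structure Cong (T T' : Mon c) : Prop where
  isShuffle_left : T.IsShuffle
  isShuffle_right : T'.IsShuffle
  nodup_left : T.labels.Nodup
  nodup_right : T'.labels.Nodup
  leafSet_eq : T'.leafSet = T.leafSet
  mem : InShIdeal (shRelations k) T.leafSet c (Finsupp.single T 1 - Finsupp.single T' 1)

theorem mapDomain_single_sub {β γ : Type*} (f : β → γ) (x y : β) :
    (Finsupp.single x (1 : k) - Finsupp.single y 1).mapDomain f =
      Finsupp.single (f x) 1 - Finsupp.single (f y) 1 := by
  rw [Finsupp.mapDomain_sub, Finsupp.mapDomain_single, Finsupp.mapDomain_single]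

namespace Cong

theorem refl {T : Mon c} (h : T.IsShuffle) (hd : T.labels.Nodup) : Cong k T T :=
  ⟨h, h, hd, hd, rfl, by rw [sub_self]; exact .zero⟩

theorem symm {T T' : Mon c} (h : Cong k T T') : Cong k T' T :=
  ⟨h.isShuffle_right, h.isShuffle_left, h.nodup_right, h.nodup_left, h.leafSet_eq.symm, by
    have := h.mem.smul (-1)
    rwa [neg_one_smul, neg_sub, ← h.leafSet_eq] at this⟩

theorem trans {T T' T'' : Mon c} (h : Cong k T T') (h' : Cong k T' T'') : Cong k T T'' :=
  ⟨h.isShuffle_left, h'.isShuffle_right, h.nodup_left, h'.nodup_right,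
    h'.leafSet_eq.trans h.leafSet_eq, by
    have := h.mem.add (h.leafSet_eq ▸ h'.mem)
    rwa [sub_add_sub_cancel] at this⟩

theorem of_rule {S S' : Mon c} (h : Rule S S') : Cong k S S' := by
  refine ⟨h.isShuffle_left, h.isShuffle_right, h.nodup_left, h.nodup_right, h.leafSet_eq, ?_⟩
  have hS : Finsupp.single S 1 ∈ FreeSh k S.leafSet c :=
    single_mem_freeSh k h.isShuffle_left h.nodup_left rfl
  have hS' : Finsupp.single S' 1 ∈ FreeSh k S.leafSet c :=
    single_mem_freeSh k h.isShuffle_right h.nodup_right h.leafSet_eq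
  rcases h.mem_shRelations k with hm | hm
  · exact .rel hm (Submodule.sub_mem _ hS hS')
  · have := (InShIdeal.rel hm (Submodule.sub_mem _ hS' hS)).smul (-1)
    rwa [neg_one_smul, neg_sub] at this

theorem minLabel_eq {T T' : Mon c} (h : Cong k T T') : T'.minLabel = T.minLabel :=
  minLabel_eq_of_leafSet_eq h.leafSet_eq

theorem relabel {T T' : Mon c} (h : Cong k T T') {φ : ℕ → ℕ}
    (hφ : StrictMonoOn φ {a | a ∈ T.labels}) : Cong k (T.relabel φ) (T'.relabel φ) := by
  have hφ' : StrictMonoOn φ {a | a ∈ T'.labels} := by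
    simpa only [mem_labels_iff_of_leafSet_eq h.leafSet_eq] using hφ
  have hφT : StrictMonoOn φ (CSet.labels T.leafSet) := hφ.mono fun a ha => mem_labels_leafSet.1 ha
  have h₁ := HasLeaves.relabel (X := T.leafSet) ⟨h.nodup_left, rfl⟩ hφT.injOn
  have h₂ := HasLeaves.relabel (X := T.leafSet) ⟨h.nodup_right, h.leafSet_eq⟩ hφT.injOn
  refine ⟨h.isShuffle_left.relabel hφ, h.isShuffle_right.relabel hφ', h₁.1, h₂.1,
    h₂.2.trans h₁.2.symm, ?_⟩
  have := h.mem.relabel φ hφT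
  rw [mapDomain_single_sub] at this
  rwa [show (T.relabel φ).leafSet = _ from h₁.2]

theorem disjoint_labels_erase {T : Mon c} {S : Mon d} {p : ℕ × Colour}
    (h : ∀ q ∈ T.leaves, q ≠ p → q.1 ∉ S.labels) :
    Disjoint (CSet.labels (T.leafSet.erase p)) (CSet.labels S.leafSet) := by
  rw [Set.disjoint_left]
  rintro a ⟨v, hv⟩ ha
  rw [Finset.mem_erase, mem_leafSet] at hv
  exact h _ hv.2 hv.1 (mem_labels_leafSet.1 ha)

/-- Congruent trees stay congruent when the same tree is grafted on both. -/
theorem graft_right {T T' : Mon c} (h : Cong k T T') {S : Mon d} (hS : S.IsShuffle)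
    (hd : S.labels.Nodup) (hm : (S.minLabel, d) ∈ T.leaves)
    (hdisj : ∀ p ∈ T.leaves, p ≠ (S.minLabel, d) → p.1 ∉ S.labels) :
    Cong k (T.graft S.minLabel S) (T'.graft S.minLabel S) := by
  have hD := disjoint_labels_erase hdisj
  have hm' : (S.minLabel, d) ∈ T.leafSet := mem_leafSet.2 hm
  have h₁ := HasLeaves.graft (X := T.leafSet) (Y := S.leafSet) ⟨h.nodup_left, rfl⟩ ⟨hd, rfl⟩ hm' hD
  have h₂ := HasLeaves.graft (X := T.leafSet) (Y := S.leafSet) ⟨h.nodup_right, h.leafSet_eq⟩ ⟨hd, rfl⟩ hm' hD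
  refine ⟨h.isShuffle_left.graft hS, h.isShuffle_right.graft hS, h₁.1, h₂.1,
    h₂.2.trans h₁.2.symm, ?_⟩
  have := h.mem.comp_right (Y := S.leafSet) hS ⟨hd, rfl⟩ hm' S.isLeast_minLabel hD
  rw [mapDomain_single_sub] at this
  rwa [show (T.graft S.minLabel S).leafSet = _ from h₁.2]

/-- Grafting congruent trees on the same tree gives congruent trees. -/
theorem graft_left {S S' : Mon d} (h : Cong k S S') {T : Mon c} (hT : T.IsShuffle)
    (hd : T.labels.Nodup) (hm : (S.minLabel, d) ∈ T.leaves)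
    (hdisj : ∀ p ∈ T.leaves, p ≠ (S.minLabel, d) → p.1 ∉ S.labels) :
    Cong k (T.graft S.minLabel S) (T.graft S.minLabel S') := by
  have hD := disjoint_labels_erase hdisj
  have hm' : (S.minLabel, d) ∈ T.leafSet := mem_leafSet.2 hm
  have h₁ := HasLeaves.graft (X := T.leafSet) (Y := S.leafSet) ⟨hd, rfl⟩ ⟨h.nodup_left, rfl⟩ hm' hD
  have h₂ := HasLeaves.graft (X := T.leafSet) (Y := S.leafSet) ⟨hd, rfl⟩ ⟨h.nodup_right, h.leafSet_eq⟩ hm' hD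
  refine ⟨hT.graft h.isShuffle_left, ?_, h₁.1, h₂.1, h₂.2.trans h₁.2.symm, ?_⟩
  · rw [← h.minLabel_eq]
    exact hT.graft h.isShuffle_right
  have := InShIdeal.comp_left (X := T.leafSet) hT ⟨hd, rfl⟩ h.mem hm' S.isLeast_minLabel hD
  rw [mapDomain_single_sub] at this
  rwa [show (T.graft S.minLabel S).leafSet = _ from h₁.2]

/-! #### Compatibility with the generators -/

theorem i {t t' : Mon .idl} (h : Cong k t t') : Cong k (.i t) (.i t') := by
  have := h.graft_left (T := .i (leaf .idl t.minLabel)) trivial (by simp) (by simp [leaves])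
    (by simp [leaves])
  simpa using this

theorem not_mem_of_ne {s : Mon c} {t : Mon d} (h : s.labels.Disjoint t.labels)
    {p q : ℕ × Colour} (hp : p = q ∨ p ∈ t.leaves) (hne : p ≠ q) : p.1 ∉ s.labels :=
  fun hh => h hh (mem_labels_of_mem (hp.resolve_left hne))

theorem α_left {s s' : Mon .alg} {t : Mon .alg} (h : Cong k s s') (hT : (α s t).IsShuffle)
    (hd : (α s t).labels.Nodup) : Cong k (α s t) (α s' t) := by
  simp only [labels_α, List.nodup_append'] at hd
  have hs : s.minLabel ∉ t.labels := fun hh => hd.2.2 s.minLabel_mem hh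
  have := h.graft_left (T := α (leaf .alg s.minLabel) t) ⟨hT.1, trivial, hT.2.2⟩
    (by simpa using ⟨hs, hd.2.1⟩) (by simp [leaves]) fun p hp hne =>
      not_mem_of_ne hd.2.2 (by simpa [leaves] using hp) hne
  simpa [graft_of_not_mem _ hs] using this

theorem α_right {s : Mon .alg} {t t' : Mon .alg} (h : Cong k t t') (hT : (α s t).IsShuffle)
    (hd : (α s t).labels.Nodup) : Cong k (α s t) (α s t') := by
  simp only [labels_α, List.nodup_append'] at hd
  have hs : t.minLabel ∉ s.labels := fun hh => hd.2.2 hh t.minLabel_mem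
  have := h.graft_left (T := α s (leaf .alg t.minLabel)) ⟨hT.1, hT.2.1, trivial⟩
    (by simpa [List.nodup_append'] using ⟨hd.1, hs⟩) (by simp [leaves]) fun p hp hne =>
      not_mem_of_ne hd.2.2.symm (by simpa [leaves, or_comm] using hp) hne
  simpa [graft_of_not_mem _ hs] using this

theorem l_left {s s' : Mon .alg} {t : Mon .idl} (h : Cong k s s') (hT : (l s t).IsShuffle)
    (hd : (l s t).labels.Nodup) : Cong k (l s t) (l s' t) := by
  simp only [labels_l, List.nodup_append'] at hd
  have hs : s.minLabel ∉ t.labels := fun hh => hd.2.2 s.minLabel_mem hh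
  have := h.graft_left (T := l (leaf .alg s.minLabel) t) ⟨hT.1, trivial, hT.2.2⟩
    (by simpa using ⟨hs, hd.2.1⟩) (by simp [leaves]) fun p hp hne =>
      not_mem_of_ne hd.2.2 (by simpa [leaves] using hp) hne
  simpa [graft_of_not_mem _ hs] using this

theorem l_right {s : Mon .alg} {t t' : Mon .idl} (h : Cong k t t') (hT : (l s t).IsShuffle)
    (hd : (l s t).labels.Nodup) : Cong k (l s t) (l s t') := by
  simp only [labels_l, List.nodup_append'] at hd
  have hs : t.minLabel ∉ s.labels := fun hh => hd.2.2 hh t.minLabel_mem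
  have := h.graft_left (T := l s (leaf .idl t.minLabel)) ⟨hT.1, hT.2.1, trivial⟩
    (by simpa [List.nodup_append'] using ⟨hd.1, hs⟩) (by simp [leaves]) fun p hp hne =>
      not_mem_of_ne hd.2.2.symm (by simpa [leaves, or_comm] using hp) hne
  simpa [graft_of_not_mem _ hs] using this

theorem r_left {s s' : Mon .idl} {t : Mon .alg} (h : Cong k s s') (hT : (r s t).IsShuffle)
    (hd : (r s t).labels.Nodup) : Cong k (r s t) (r s' t) := by
  simp only [labels_r, List.nodup_append'] at hd
  have hs : s.minLabel ∉ t.labels := fun hh => hd.2.2 s.minLabel_mem hh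
  have := h.graft_left (T := r (leaf .idl s.minLabel) t) ⟨hT.1, trivial, hT.2.2⟩
    (by simpa using ⟨hs, hd.2.1⟩) (by simp [leaves]) fun p hp hne =>
      not_mem_of_ne hd.2.2 (by simpa [leaves] using hp) hne
  simpa [graft_of_not_mem _ hs] using this

theorem r_right {s : Mon .idl} {t t' : Mon .alg} (h : Cong k t t') (hT : (r s t).IsShuffle)
    (hd : (r s t).labels.Nodup) : Cong k (r s t) (r s t') := by
  simp only [labels_r, List.nodup_append'] at hd
  have hs : t.minLabel ∉ s.labels := fun hh => hd.2.2 hh t.minLabel_mem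
  have := h.graft_left (T := r s (leaf .alg t.minLabel)) ⟨hT.1, hT.2.1, trivial⟩
    (by simpa [List.nodup_append'] using ⟨hd.1, hs⟩) (by simp [leaves]) fun p hp hne =>
      not_mem_of_ne hd.2.2.symm (by simpa [leaves, or_comm] using hp) hne
  simpa [graft_of_not_mem _ hs] using this

end Cong
end

/-! ### Instances of the rewriting rules -/

section

variable {k : Type*} [Field k] {c d : Colour}

open Mon

/-- The change of labels `1 ↦ a`, `2 ↦ b`, `3 ↦ e`. -/
def relabel₃ (a b e : ℕ) (n : ℕ) : ℕ := if n = 1 then a else if n = 2 then b else e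

theorem strictMonoOn_relabel₃ {a b e : ℕ} (h : a < b) (h' : b < e) :
    StrictMonoOn (relabel₃ a b e) (Set.Icc 1 3) := by
  rintro x ⟨hx, hx'⟩ y ⟨hy, hy'⟩ hxy
  unfold relabel₃
  split_ifs <;> omega

variable {c₁ c₂ c₃ : Colour} {x : Mon c₁} {y : Mon c₂} {z : Mon c₃}

/-- The substitution of the trees `x`, `y`, `z` for the leaves `1`, `2`, `3`. -/
def assign (x : Mon c₁) (y : Mon c₂) (z : Mon c₃) (c : Colour) (n : ℕ) : Mon c :=
  if n = 1 then plug 1 x c n else if n = 2 then plug 2 y c n else plug 3 z c n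

/-- Simultaneous substitution for three leaves is a change of labels followed by three graftings. -/
theorem graft_graft_graft {S : Mon c}
    (hS : ∀ p, p ∈ S.leaves → p = (1, c₁) ∨ p = (2, c₂) ∨ p = (3, c₃))
    (hxy : x.minLabel < y.minLabel) (hyz : y.minLabel < z.minLabel)
    (dxy : x.labels.Disjoint y.labels) (dxz : x.labels.Disjoint z.labels)
    (dyz : y.labels.Disjoint z.labels) :
    (((S.relabel (relabel₃ x.minLabel y.minLabel z.minLabel)).graft x.minLabel x).graft
      y.minLabel y).graft z.minLabel z = S.subst (assign x y z) := by
  induction S with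
  | leaf c n =>
    have nyx : y.minLabel ∉ x.labels := fun hh => dxy hh y.minLabel_mem
    have nzx : z.minLabel ∉ x.labels := fun hh => dxz hh z.minLabel_mem
    have nzy : z.minLabel ∉ y.labels := fun hh => dyz hh z.minLabel_mem
    rcases hS (n, c) (by simp [leaves]) with h | h | h <;> cases h
    · simp [relabel₃, subst, assign, graft_of_not_mem _ nyx, graft_of_not_mem _ nzx]
    · simp [relabel₃, subst, assign, plug_of_ne _ hxy.ne', graft_of_not_mem _ nzy]
    · simp [relabel₃, subst, assign, plug_of_ne _ hyz.ne', plug_of_ne _ (hxy.trans hyz).ne']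
  | i t ih => simp [subst, ih hS]
  | α s t ih₁ ih₂ | l s t ih₁ ih₂ | r s t ih₁ ih₂ =>
    simp only [leaves, List.mem_append] at hS
    simp [subst, ih₁ fun p hp => hS p (.inl hp), ih₂ fun p hp => hS p (.inr hp)]

/-- Simultaneous substitution for two leaves is a change of labels followed by two graftings. -/
theorem graft_graft {S : Mon c} (hS : ∀ p, p ∈ S.leaves → p = (1, c₁) ∨ p = (2, c₂)) (e : ℕ)
    (hxy : x.minLabel < y.minLabel) (dxy : x.labels.Disjoint y.labels) :
    ((S.relabel (relabel₃ x.minLabel y.minLabel e)).graft x.minLabel x).graft y.minLabel y =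
      S.subst (assign x y z) := by
  induction S with
  | leaf c n =>
    have nyx : y.minLabel ∉ x.labels := fun hh => dxy hh y.minLabel_mem
    rcases hS (n, c) (by simp [leaves]) with h | h <;> cases h
    · simp [relabel₃, subst, assign, graft_of_not_mem _ nyx]
    · simp [relabel₃, subst, assign, plug_of_ne _ hxy.ne']
  | i t ih => simp [subst, ih hS]
  | α s t ih₁ ih₂ | l s t ih₁ ih₂ | r s t ih₁ ih₂ =>
    simp only [leaves, List.mem_append] at hS
    simp [subst, ih₁ fun p hp => hS p (.inl hp), ih₂ fun p hp => hS p (.inr hp)]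

variable (k) in
/-- One application of a rewriting rule at the root: `T` and `T'` are congruent, and `T` is divisible
by the larger side of a rule. -/
structure Step (T T' : Mon c) : Prop where
  cong : Cong k T T'
  divides : ∃ S S' : Mon c, Rule S S' ∧ S.Divides T

namespace Step

/-- Substituting trees with increasing smallest labels in a rule with three leaves. -/
theorem of_rule₃ {S S' : Mon c} (h : Rule S S')
    (hS : ∀ p, p ∈ S.leaves ↔ p = (1, c₁) ∨ p = (2, c₂) ∨ p = (3, c₃))
    (hx : x.IsShuffle) (hy : y.IsShuffle) (hz : z.IsShuffle)
    (dx : x.labels.Nodup) (dy : y.labels.Nodup) (dz : z.labels.Nodup)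
    (hxy : x.minLabel < y.minLabel) (hyz : y.minLabel < z.minLabel)
    (dxy : x.labels.Disjoint y.labels) (dxz : x.labels.Disjoint z.labels)
    (dyz : y.labels.Disjoint z.labels) :
    Step k (S.subst (assign x y z)) (S'.subst (assign x y z)) := by
  have hS' : ∀ p, p ∈ S'.leaves → p = (1, c₁) ∨ p = (2, c₂) ∨ p = (3, c₃) := fun p hp =>
    (hS p).1 ((mem_leaves_iff_of_leafSet_eq h.leafSet_eq).1 hp)
  refine ⟨?_, S, S', h, assign x y z, .self, ?_⟩
  · rw [← graft_graft_graft (fun p => (hS p).1) hxy hyz dxy dxz dyz,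
      ← graft_graft_graft hS' hxy hyz dxy dxz dyz]
    have hmono : StrictMonoOn (relabel₃ x.minLabel y.minLabel z.minLabel) {a | a ∈ S.labels} := by
      refine (strictMonoOn_relabel₃ hxy hyz).mono fun a ha => ?_
      obtain ⟨v, hv⟩ := mem_labels.1 ha
      rcases (hS _).1 hv with hv | hv | hv <;> cases hv <;> simp
    have hl : ∀ p, p ∈ (S.relabel (relabel₃ x.minLabel y.minLabel z.minLabel)).leaves ↔
        p = (x.minLabel, c₁) ∨ p = (y.minLabel, c₂) ∨ p = (z.minLabel, c₃) := by
      intro p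
      rw [leaves_relabel, List.mem_map]
      simp [hS, or_and_right, exists_or, relabel₃, eq_comm]
    have nxy : x.minLabel ∉ y.labels := fun hh => dxy x.minLabel_mem hh
    have nxz : x.minLabel ∉ z.labels := fun hh => dxz x.minLabel_mem hh
    have nyx : y.minLabel ∉ x.labels := fun hh => dxy hh y.minLabel_mem
    have nyz : y.minLabel ∉ z.labels := fun hh => dyz y.minLabel_mem hh
    have nzx : z.minLabel ∉ x.labels := fun hh => dxz hh z.minLabel_mem
    have nzy : z.minLabel ∉ y.labels := fun hh => dyz hh z.minLabel_mem
    have h₁ := ((Cong.of_rule h).relabel hmono).graft_right (k := k) hx dx ((hl _).2 (.inl rfl)) (by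
      intro p hp hne
      rcases (hl p).1 hp with rfl | rfl | rfl
      exacts [absurd rfl hne, nyx, nzx])
    have h₂ := h₁.graft_right hy dy (mem_leaves_graft.2 (.inl ⟨(hl _).2 (.inr (.inl rfl)), by
      simp [hxy.ne']⟩)) (by
      intro p hp hne
      rcases mem_leaves_graft.1 hp with ⟨hp, -⟩ | ⟨-, hp⟩
      · rcases (hl p).1 hp with rfl | rfl | rfl
        exacts [nxy, absurd rfl hne, nzy]
      · exact fun hh => dxy (mem_labels_of_mem hp) hh)
    refine h₂.graft_right hz dz (mem_leaves_graft.2 (.inl ⟨mem_leaves_graft.2 (.inl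
      ⟨(hl _).2 (.inr (.inr rfl)), by simp [(hxy.trans hyz).ne']⟩), by simp [hyz.ne']⟩)) ?_
    intro p hp hne
    rcases mem_leaves_graft.1 hp with ⟨hp, -⟩ | ⟨-, hp⟩
    · rcases mem_leaves_graft.1 hp with ⟨hp, -⟩ | ⟨-, hp⟩
      · rcases (hl p).1 hp with rfl | rfl | rfl
        exacts [nxz, nyz, absurd rfl hne]
      · exact fun hh => dxz (mem_labels_of_mem hp) hh
    · exact fun hh => dyz (mem_labels_of_mem hp) hh
  · intro p hp q hq hpq
    rcases (hS p).1 hp with rfl | rfl | rfl <;> rcases (hS q).1 hq with rfl | rfl | rfl <;>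
      first | (simp at hpq; done) | simp [assign, hxy, hyz, hxy.trans hyz]

/-- Substituting trees with increasing smallest labels in a rule with two leaves. -/
theorem of_rule₂ {S S' : Mon c} (h : Rule S S')
    (hS : ∀ p, p ∈ S.leaves ↔ p = (1, c₁) ∨ p = (2, c₂))
    (hx : x.IsShuffle) (hy : y.IsShuffle) (dx : x.labels.Nodup) (dy : y.labels.Nodup)
    (hxy : x.minLabel < y.minLabel) (dxy : x.labels.Disjoint y.labels) :
    Step k (S.subst (assign x y z)) (S'.subst (assign x y z)) := by
  have hS' : ∀ p, p ∈ S'.leaves → p = (1, c₁) ∨ p = (2, c₂) := fun p hp =>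
    (hS p).1 ((mem_leaves_iff_of_leafSet_eq h.leafSet_eq).1 hp)
  refine ⟨?_, S, S', h, assign x y z, .self, ?_⟩
  -- The value `y.minLabel + 1` at `3` is not used; it only keeps the change of labels monotone.
  · rw [← graft_graft (fun p => (hS p).1) (y.minLabel + 1) hxy dxy,
      ← graft_graft hS' (y.minLabel + 1) hxy dxy]
    have hmono : StrictMonoOn (relabel₃ x.minLabel y.minLabel (y.minLabel + 1))
        {a | a ∈ S.labels} := by
      refine (strictMonoOn_relabel₃ hxy (Nat.lt_succ_self _)).mono fun a ha => ?_
      obtain ⟨v, hv⟩ := mem_labels.1 ha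
      rcases (hS _).1 hv with hv | hv <;> cases hv <;> simp
    have hl : ∀ p, p ∈ (S.relabel (relabel₃ x.minLabel y.minLabel (y.minLabel + 1))).leaves ↔
        p = (x.minLabel, c₁) ∨ p = (y.minLabel, c₂) := by
      intro p
      rw [leaves_relabel, List.mem_map]
      simp [hS, or_and_right, exists_or, relabel₃, eq_comm]
    have nxy : x.minLabel ∉ y.labels := fun hh => dxy x.minLabel_mem hh
    have nyx : y.minLabel ∉ x.labels := fun hh => dxy hh y.minLabel_mem
    have h₁ := ((Cong.of_rule h).relabel hmono).graft_right (k := k) hx dx ((hl _).2 (.inl rfl)) (by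
      intro p hp hne
      rcases (hl p).1 hp with rfl | rfl
      exacts [absurd rfl hne, nyx])
    refine h₁.graft_right hy dy (mem_leaves_graft.2 (.inl ⟨(hl _).2 (.inr rfl), by
      simp [hxy.ne']⟩)) ?_
    intro p hp hne
    rcases mem_leaves_graft.1 hp with ⟨hp, -⟩ | ⟨-, hp⟩
    · rcases (hl p).1 hp with rfl | rfl
      exacts [nxy, absurd rfl hne]
    · exact fun hh => dxy (mem_labels_of_mem hp) hh
  · intro p hp q hq hpq
    rcases (hS p).1 hp with rfl | rfl <;> rcases (hS q).1 hq with rfl | rfl <;>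
      first | (simp at hpq; done) | simp [assign, hxy]

variable {x y z : Mon .alg} {u v : Mon .idl}

theorem i_r (hT : (i (r u x)).IsShuffle) (hd : (i (r u x)).labels.Nodup) :
    Step k (i (r u x)) (α (i u) x) := by
  simp only [labels_i, labels_r, List.nodup_append'] at hd
  exact of_rule₂ (z := x) .i_r (by simp [leaves]) hT.2.1 hT.2.2 hd.1 hd.2.1 hT.1 hd.2.2

theorem i_l (hT : (i (l x u)).IsShuffle) (hd : (i (l x u)).labels.Nodup) :
    Step k (i (l x u)) (α x (i u)) := by
  simp only [labels_i, labels_l, List.nodup_append'] at hd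
  exact of_rule₂ (z := x) .i_l (by simp [leaves]) hT.2.1 hT.2.2 hd.1 hd.2.1 hT.1 hd.2.2

theorem l_i (hT : (l (i u) v).IsShuffle) (hd : (l (i u) v).labels.Nodup) :
    Step k (l (i u) v) (r u (i v)) := by
  simp only [labels_i, labels_l, List.nodup_append'] at hd
  exact of_rule₂ (x := u) (y := v) (z := u) .l_i (by simp [leaves]) hT.2.1 hT.2.2 hd.1 hd.2.1 hT.1 hd.2.2

/-! In the following four lemmas the tree `t` depends on the order of the smallest labels of the two
subtrees that are not at the left. -/

theorem α_α (hT : (α (α x y) z).IsShuffle) (hd : (α (α x y) z).labels.Nodup) :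
    ∃ t, Step k (α (α x y) z) (α x t) := by
  simp only [labels_α, List.nodup_append', List.disjoint_append_left] at hd
  obtain ⟨⟨dx, dy, dxy⟩, dz, dxz, dyz⟩ := hd
  obtain ⟨hm, ⟨hxy, hx, hy⟩, hz⟩ := hT
  rw [minLabel, min_eq_left hxy.le] at hm
  rcases (minLabel_ne dyz).lt_or_gt with h | h
  · exact ⟨_, of_rule₃ .α_α₁₂ (by simp [leaves]) hx hy hz dx dy dz hxy h dxy dxz dyz⟩
  · exact ⟨_, of_rule₃ .α_α₁₃ (by simp [leaves, or_comm]) hx hz hy dx dz dy hm h dxz dxy dyz.symm⟩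

theorem l_α (hT : (l (α x y) u).IsShuffle) (hd : (l (α x y) u).labels.Nodup) :
    ∃ t, Step k (l (α x y) u) (l x t) := by
  simp only [labels_α, labels_l, List.nodup_append', List.disjoint_append_left] at hd
  obtain ⟨⟨dx, dy, dxy⟩, dz, dxz, dyz⟩ := hd
  obtain ⟨hm, ⟨hxy, hx, hy⟩, hz⟩ := hT
  rw [minLabel, min_eq_left hxy.le] at hm
  rcases (minLabel_ne dyz).lt_or_gt with h | h
  · exact ⟨_, of_rule₃ .l_α₁₂ (by simp [leaves]) hx hy hz dx dy dz hxy h dxy dxz dyz⟩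
  · exact ⟨_, of_rule₃ .l_α₁₃ (by simp [leaves, or_comm]) hx hz hy dx dz dy hm h dxz dxy dyz.symm⟩

theorem r_l (hT : (r (l x u) y).IsShuffle) (hd : (r (l x u) y).labels.Nodup) :
    ∃ t, Step k (r (l x u) y) (l x t) := by
  simp only [labels_r, labels_l, List.nodup_append', List.disjoint_append_left] at hd
  obtain ⟨⟨dx, dy, dxy⟩, dz, dxz, dyz⟩ := hd
  obtain ⟨hm, ⟨hxy, hx, hy⟩, hz⟩ := hT
  rw [minLabel, min_eq_left hxy.le] at hm
  rcases (minLabel_ne dyz).lt_or_gt with h | h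
  · exact ⟨_, of_rule₃ .r_l₁₂ (by simp [leaves]) hx hy hz dx dy dz hxy h dxy dxz dyz⟩
  · exact ⟨_, of_rule₃ .r_l₁₃ (by simp [leaves, or_comm]) hx hz hy dx dz dy hm h dxz dxy dyz.symm⟩

theorem r_r (hT : (r (r u x) y).IsShuffle) (hd : (r (r u x) y).labels.Nodup) :
    ∃ t, Step k (r (r u x) y) (r u t) := by
  simp only [labels_r, List.nodup_append', List.disjoint_append_left] at hd
  obtain ⟨⟨dx, dy, dxy⟩, dz, dxz, dyz⟩ := hd
  obtain ⟨hm, ⟨hxy, hx, hy⟩, hz⟩ := hT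
  rw [minLabel, min_eq_left hxy.le] at hm
  rcases (minLabel_ne dyz).lt_or_gt with h | h
  · exact ⟨_, of_rule₃ .r_r₁₂ (by simp [leaves]) hx hy hz dx dy dz hxy h dxy dxz dyz⟩
  · exact ⟨_, of_rule₃ .r_r₁₃ (by simp [leaves, or_comm]) hx hz hy dx dz dy hm h dxz dxy dyz.symm⟩

end Step
end

/-! ### Normal forms -/

section

variable (k : Type*) [Field k] {c : Colour}

open Mon

namespace Mon

/-- The trees whose smallest leaf stands alone (or under a single `i`) at the left of the root. -/
inductive Headed : {c : Colour} → Mon c → Prop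
  | leaf (c : Colour) (a : ℕ) : Headed (leaf c a)
  | i_leaf (a : ℕ) : Headed (i (leaf .idl a))
  | α_leaf (a : ℕ) (t : Mon .alg) : Headed (α (leaf .alg a) t)
  | α_i_leaf (a : ℕ) (t : Mon .alg) : Headed (α (i (leaf .idl a)) t)
  | l_leaf (a : ℕ) (t : Mon .idl) : Headed (l (leaf .alg a) t)
  | r_leaf (a : ℕ) (t : Mon .alg) : Headed (r (leaf .idl a) t)

theorem IsSubtreeOf.divides_of_divides {d e : Colour} {U : Mon e} {T : Mon c} (h : U.IsSubtreeOf T)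
    {S : Mon d} (hS : S.Divides U) : S.Divides T := by
  obtain ⟨σ, hσ, hm⟩ := hS
  refine ⟨σ, ?_, hm⟩
  clear hm
  induction h with
  | self => exact hσ
  | i _ ih => exact .i ih
  | α_left _ ih => exact .α_left ih
  | α_right _ ih => exact .α_right ih
  | l_left _ ih => exact .l_left ih
  | l_right _ ih => exact .l_right ih
  | r_left _ ih => exact .r_left ih
  | r_right _ ih => exact .r_right ih

end Mon

/-- Modulo the relations, the leaf with the smallest label can be pulled down to the root. -/
theorem exists_cong_headed {T : Mon c} (hT : T.IsShuffle) (hd : T.labels.Nodup) :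
    ∃ H : Mon c, H.Headed ∧ Cong k T H := by
  -- By induction the left input of the root is headed, and then one rule applies at the root. Only
  -- `l (α (i a) s) t` takes two steps, through `l (i a) u`.
  induction T with
  | leaf c a => exact ⟨_, .leaf c a, .refl hT hd⟩
  | i t ih =>
    obtain ⟨H, hH, h⟩ := ih hT hd
    have h := h.i
    cases hH with
    | leaf _ a => exact ⟨_, .i_leaf a, h⟩
    | l_leaf a t => exact ⟨_, .α_leaf _ _, h.trans (Step.i_l h.isShuffle_right h.nodup_right).cong⟩
    | r_leaf a t =>
      exact ⟨_, .α_i_leaf _ _, h.trans (Step.i_r h.isShuffle_right h.nodup_right).cong⟩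
  | α s t ih _ =>
    obtain ⟨H, hH, h⟩ := ih hT.2.1 (List.nodup_append'.1 (labels_α s t ▸ hd)).1
    have h := h.α_left hT hd
    cases hH with
    | leaf _ a => exact ⟨_, .α_leaf a t, h⟩
    | i_leaf a => exact ⟨_, .α_i_leaf a t, h⟩
    | α_leaf a s =>
      obtain ⟨u, hu⟩ := Step.α_α (k := k) h.isShuffle_right h.nodup_right
      exact ⟨_, .α_leaf a u, h.trans hu.cong⟩
    | α_i_leaf a s =>
      obtain ⟨u, hu⟩ := Step.α_α (k := k) h.isShuffle_right h.nodup_right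
      exact ⟨_, .α_i_leaf a u, h.trans hu.cong⟩
  | l s t ih _ =>
    obtain ⟨H, hH, h⟩ := ih hT.2.1 (List.nodup_append'.1 (labels_l s t ▸ hd)).1
    have h := h.l_left hT hd
    cases hH with
    | leaf _ a => exact ⟨_, .l_leaf a t, h⟩
    | i_leaf a => exact ⟨_, .r_leaf _ _, h.trans (Step.l_i h.isShuffle_right h.nodup_right).cong⟩
    | α_leaf a s =>
      obtain ⟨u, hu⟩ := Step.l_α (k := k) h.isShuffle_right h.nodup_right
      exact ⟨_, .l_leaf a u, h.trans hu.cong⟩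
    | α_i_leaf a s =>
      obtain ⟨u, hu⟩ := Step.l_α (k := k) h.isShuffle_right h.nodup_right
      have h := h.trans hu.cong
      exact ⟨_, .r_leaf _ _, h.trans (Step.l_i h.isShuffle_right h.nodup_right).cong⟩
  | r s t ih _ =>
    obtain ⟨H, hH, h⟩ := ih hT.2.1 (List.nodup_append'.1 (labels_r s t ▸ hd)).1
    have h := h.r_left hT hd
    cases hH with
    | leaf _ a => exact ⟨_, .r_leaf a t, h⟩
    | l_leaf a s =>
      obtain ⟨u, hu⟩ := Step.r_l (k := k) h.isShuffle_right h.nodup_right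
      exact ⟨_, .l_leaf a u, h.trans hu.cong⟩
    | r_leaf a s =>
      obtain ⟨u, hu⟩ := Step.r_r (k := k) h.isShuffle_right h.nodup_right
      exact ⟨_, .r_leaf a u, h.trans hu.cong⟩

theorem exists_cong_normal {T : Mon c} (hT : T.IsShuffle) (hd : T.labels.Nodup) :
    ∃ N : Mon c, N.Normal ∧ Cong k T N := by
  induction hn : T.labels.length using Nat.strong_induction_on generalizing c T with
  | _ n ih =>
    obtain ⟨H, hH, h⟩ := exists_cong_headed k hT hd
    have hlen := (labels_perm_of_leafSet_eq h.nodup_right hd h.leafSet_eq).length_eq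
    have hs := h.isShuffle_right
    have hd' := h.nodup_right
    cases hH with
    | leaf _ a => exact ⟨_, .leaf _ a, h⟩
    | i_leaf a => exact ⟨_, .i_leaf a, h⟩
    | α_leaf a t =>
      obtain ⟨N, hN, h'⟩ := ih t.labels.length (by simp at hlen; omega) hs.2.2
        (List.nodup_append'.1 (labels_α _ t ▸ hd')).2.1 rfl
      exact ⟨_, .α_leaf a hN, h.trans (h'.α_right hs hd')⟩
    | α_i_leaf a t =>
      obtain ⟨N, hN, h'⟩ := ih t.labels.length (by simp at hlen; omega) hs.2.2
        (List.nodup_append'.1 (labels_α _ t ▸ hd')).2.1 rfl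
      exact ⟨_, .α_i_leaf a hN, h.trans (h'.α_right hs hd')⟩
    | l_leaf a t =>
      obtain ⟨N, hN, h'⟩ := ih t.labels.length (by simp at hlen; omega) hs.2.2
        (List.nodup_append'.1 (labels_l _ t ▸ hd')).2.1 rfl
      exact ⟨_, .l_leaf a hN, h.trans (h'.l_right hs hd')⟩
    | r_leaf a t =>
      obtain ⟨N, hN, h'⟩ := ih t.labels.length (by simp at hlen; omega) hs.2.2
        (List.nodup_append'.1 (labels_r _ t ▸ hd')).2.1 rfl
      exact ⟨_, .r_leaf a hN, h.trans (h'.r_right hs hd')⟩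

/-- Any two shuffle trees with the same leaves and the same colour of the output are congruent. -/
theorem cong_of_leafSet_eq {T T' : Mon c} (hT : T.IsShuffle) (hT' : T'.IsShuffle)
    (hd : T.labels.Nodup) (hd' : T'.labels.Nodup) (e : T'.leafSet = T.leafSet) : Cong k T T' := by
  obtain ⟨N, hN, h⟩ := exists_cong_normal k hT hd
  obtain ⟨N', hN', h'⟩ := exists_cong_normal k hT' hd'
  obtain rfl := hN.unique hN' h.isShuffle_right h'.isShuffle_right h.nodup_right h'.nodup_right
    (h.leafSet_eq.trans (e.symm.trans h'.leafSet_eq.symm))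
  exact h.trans h'.symm

variable {k} in
theorem Step.exists_divides {T T' : Mon c} (h : Step k T T') :
    ∃ (d : Colour) (S S' : Mon d), Rule S S' ∧ S.Divides T :=
  ⟨c, h.divides⟩

/-- A shuffle tree that is not normal is divisible by the larger side of a rewriting rule. -/
theorem normal_or_exists_divides {T : Mon c} (hT : T.IsShuffle) (hd : T.labels.Nodup) :
    T.Normal ∨ ∃ (d : Colour) (S S' : Mon d), Rule S S' ∧ S.Divides T := by
  -- The divisibility in `Step k` does not depend on the field `k`, and `ℚ` serves as well as any.
  induction T with
  | leaf c a => exact .inl (.leaf c a)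
  | i t ih =>
    rcases ih hT hd with h | ⟨d, S, S', h, h'⟩
    · cases h with
      | leaf _ a => exact .inl (.i_leaf a)
      | l_leaf a h => exact .inr (Step.i_l (k := ℚ) hT hd).exists_divides
      | r_leaf a h => exact .inr (Step.i_r (k := ℚ) hT hd).exists_divides
    · exact .inr ⟨d, S, S', h, (IsSubtreeOf.i .self).divides_of_divides h'⟩
  | α s t ih₁ ih₂ =>
    have hd' := List.nodup_append'.1 (labels_α s t ▸ hd)
    rcases ih₁ hT.2.1 hd'.1 with h | ⟨d, S, S', h, h'⟩
    · rcases ih₂ hT.2.2 hd'.2.1 with ht | ⟨d, S, S', h, h'⟩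
      · cases h with
        | leaf _ a => exact .inl (.α_leaf a ht)
        | i_leaf a => exact .inl (.α_i_leaf a ht)
        | α_leaf | α_i_leaf => exact .inr (Step.α_α (k := ℚ) hT hd).choose_spec.exists_divides
      · exact .inr ⟨d, S, S', h, (IsSubtreeOf.α_right .self).divides_of_divides h'⟩
    · exact .inr ⟨d, S, S', h, (IsSubtreeOf.α_left .self).divides_of_divides h'⟩
  | l s t ih₁ ih₂ =>
    have hd' := List.nodup_append'.1 (labels_l s t ▸ hd)
    rcases ih₁ hT.2.1 hd'.1 with h | ⟨d, S, S', h, h'⟩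
    · rcases ih₂ hT.2.2 hd'.2.1 with ht | ⟨d, S, S', h, h'⟩
      · cases h with
        | leaf _ a => exact .inl (.l_leaf a ht)
        | i_leaf a => exact .inr (Step.l_i (k := ℚ) hT hd).exists_divides
        | α_leaf | α_i_leaf => exact .inr (Step.l_α (k := ℚ) hT hd).choose_spec.exists_divides
      · exact .inr ⟨d, S, S', h, (IsSubtreeOf.l_right .self).divides_of_divides h'⟩
    · exact .inr ⟨d, S, S', h, (IsSubtreeOf.l_left .self).divides_of_divides h'⟩
  | r s t ih₁ ih₂ =>
    have hd' := List.nodup_append'.1 (labels_r s t ▸ hd)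
    rcases ih₁ hT.2.1 hd'.1 with h | ⟨d, S, S', h, h'⟩
    · rcases ih₂ hT.2.2 hd'.2.1 with ht | ⟨d, S, S', h, h'⟩
      · cases h with
        | leaf _ a => exact .inl (.r_leaf a ht)
        | l_leaf => exact .inr (Step.r_l (k := ℚ) hT hd).choose_spec.exists_divides
        | r_leaf => exact .inr (Step.r_r (k := ℚ) hT hd).choose_spec.exists_divides
      · exact .inr ⟨d, S, S', h, (IsSubtreeOf.r_right .self).divides_of_divides h'⟩
    · exact .inr ⟨d, S, S', h, (IsSubtreeOf.r_left .self).divides_of_divides h'⟩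

end

/-! ### The ideals of relations -/

section

variable {k : Type*} [Field k] {c : Colour}

open Mon

theorem mapDomain_mem_supported {β γ : Type*} {g : β → γ} {s : Set β} {t : Set γ}
    (h : Set.MapsTo g s t) {f : β →₀ k} (hf : f ∈ Finsupp.supported k k s) :
    f.mapDomain g ∈ Finsupp.supported k k t := by
  classical
  intro y hy
  obtain ⟨x, hx, rfl⟩ := Finset.mem_image.1 (Finsupp.mapDomain_support hy)
  exact h (hf hx)

variable (k) in
/-- The sum of the coefficients. -/
noncomputable def coeffSum (β : Type*) : (β →₀ k) →ₗ[k] k :=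
  Finsupp.linearCombination k fun _ => 1

@[simp] theorem coeffSum_single {β : Type*} (x : β) (a : k) :
    coeffSum k β (Finsupp.single x a) = a := by
  simp [coeffSum]

@[simp] theorem coeffSum_mapDomain {β γ : Type*} (g : β → γ) (f : β →₀ k) :
    coeffSum k γ (f.mapDomain g) = coeffSum k β f := by
  rw [coeffSum, Finsupp.linearCombination_mapDomain]
  rfl

/-- The linear combinations with coefficient sum zero are spanned by differences. -/
theorem mem_of_coeffSum_eq_zero {β : Type*} {s : Set β} {P : Submodule k (β →₀ k)}
    (hP : ∀ x ∈ s, ∀ y ∈ s, Finsupp.single x 1 - Finsupp.single y 1 ∈ P) {f : β →₀ k}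
    (hf : f ∈ Finsupp.supported k k s) (h0 : coeffSum k β f = 0) : f ∈ P := by
  rcases f.support.eq_empty_or_nonempty with h | ⟨x₀, hx₀⟩
  · rw [Finsupp.support_eq_empty.1 h]
    exact P.zero_mem
  · have : f = f.sum fun x a => a • (Finsupp.single x 1 - Finsupp.single x₀ 1) := by
      rw [coeffSum, Finsupp.linearCombination_apply] at h0
      simp only [smul_sub, Finsupp.sum_sub, Finsupp.smul_single, smul_eq_mul, mul_one] at h0 ⊢
      rw [Finsupp.sum_single, Finsupp.sum, ← Finsupp.single_finsetSum]
      rw [Finsupp.sum] at h0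
      rw [h0, Finsupp.single_zero, sub_zero]
    rw [this]
    exact P.sum_mem fun x hx => P.smul_mem _ (hP x (hf hx) x₀ (hf hx₀))

theorem DefRel.exists_eq {n : ℕ} {f : SMon c →₀ k} (h : DefRel k n c f) :
    ∃ (A B : Mon c) (Y : CSet), f = mon k A - mon k B ∧ A.vertices = 2 ∧ B.vertices = 2 ∧
      A.HasLeaves Y ∧ B.HasLeaves Y := by
  cases h
  all_goals
    refine ⟨_, _, _, rfl, rfl, rfl, ⟨?_, rfl⟩, ⟨?_, ?_⟩⟩
    · decide
    · decide
    · decide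

theorem mon_sub_mem_freeSym {A B : Mon c} {Y : CSet} (hA : A.HasLeaves Y)
    (hB : B.HasLeaves Y) : mon k A - mon k B ∈ FreeSym k Y c :=
  Submodule.sub_mem _ (Finsupp.single_mem_supported k 1 hA) (Finsupp.single_mem_supported k 1 hB)

theorem InSymIdeal.coeffSum_eq_zero {X : CSet} {f : SMon c →₀ k}
    (h : InSymIdeal (fun c => {f | ∃ n, DefRel k n c f}) X c f) : coeffSum k _ f = 0 := by
  induction h with
  | rel h _ =>
    obtain ⟨n, h⟩ := h
    obtain ⟨A, B, Y, rfl, -⟩ := h.exists_eq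
    simp [mon]
  | zero => simp
  | add _ _ h₁ h₂ => rw [map_add, h₁, h₂, add_zero]
  | smul x _ h => rw [map_smul, h, smul_zero]
  | relabel φ _ _ h | comp_right _ _ _ _ h | comp_left _ _ _ _ h => rwa [coeffSum_mapDomain]

theorem InShIdeal.mem_freeSh {G : (c : Colour) → Set (Mon c →₀ k)} {X : CSet} {f : Mon c →₀ k}
    (h : InShIdeal G X c f) : f ∈ FreeSh k X c := by
  induction h with
  | rel _ h => exact h
  | zero => exact Submodule.zero_mem _
  | add _ _ h₁ h₂ => exact Submodule.add_mem _ h₁ h₂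
  | smul x _ h => exact Submodule.smul_mem _ x h
  | relabel φ hφ _ h =>
    refine mapDomain_mem_supported (fun T hT => ?_) h
    refine ⟨hT.1.relabel (hφ.mono fun a ha => ?_), hT.2.relabel hφ.injOn⟩
    rw [← hT.2.2]
    exact mem_labels_leafSet.2 ha
  | comp_right _ hS hS' hm ha hd h =>
    refine mapDomain_mem_supported (fun T hT => ?_) h
    refine ⟨?_, hT.2.graft hS' hm hd⟩
    obtain ⟨-, rfl⟩ := hS'
    rw [ha.unique (isLeast_minLabel _)]
    exact hT.1.graft hS
  | comp_left hT hT' _ hm ha hd h =>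
    refine mapDomain_mem_supported (fun S hS => ?_) h
    refine ⟨?_, hT'.graft hS.2 hm hd⟩
    obtain ⟨hS, -, rfl⟩ := hS
    rw [ha.unique (isLeast_minLabel _)]
    exact hT.graft hS

theorem forgetPlanar_mem_freeSym {X : CSet} {f : Mon c →₀ k} (h : f ∈ FreeSh k X c) :
    forgetPlanar k c f ∈ FreeSym k X c :=
  mapDomain_mem_supported (fun _ hT => hT.2) h

theorem forgetPlanar_mapDomain {d : Colour} {g : Mon c → Mon d} {g' : SMon c → SMon d}
    (h : ∀ T, SMon.mk (g T) = g' (SMon.mk T)) (f : Mon c →₀ k) :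
    forgetPlanar k d (f.mapDomain g) = (forgetPlanar k c f).mapDomain g' := by
  simp only [forgetPlanar, Finsupp.lmapDomain_apply, ← Finsupp.mapDomain_comp]
  exact congrArg (fun u => Finsupp.mapDomain u f) (funext h)

/-- The shuffle ideal generated by the quadratic relations vanishes in `ICom`. -/
theorem InShIdeal.forgetPlanar_mem {X : CSet} {f : Mon c →₀ k}
    (h : InShIdeal (shRelations k) X c f) : forgetPlanar k c f ∈ relIdeal k X c := by
  induction h with
  | @rel X c g h hX =>
    obtain ⟨-, n, f, hf, σ, -, e⟩ := h
    -- Unless it vanishes, the image of `g` lies in only one component, which identifies `X`.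
    by_cases h0 : forgetPlanar k c g = 0
    · rw [h0]
      exact .zero
    · obtain ⟨A, B, Y, rfl, -, -, hA, hB⟩ := hf.exists_eq
      have hmem := mon_sub_mem_freeSym (k := k) hA hB
      have hr := InSymIdeal.relabel σ σ.injective.injOn
        (InSymIdeal.rel (R := fun c => {f | ∃ n, DefRel k n c f}) ⟨n, hf⟩ hmem)
      obtain ⟨T, hT⟩ := Finsupp.support_nonempty_iff.2 h0
      obtain ⟨U, rfl⟩ := Quotient.exists_rep T
      have h₁ : U.HasLeaves X := forgetPlanar_mem_freeSym hX hT
      have h₂ : U.HasLeaves (Y.image (Prod.map σ id)) := by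
        rw [e, mapDomain_relabel_mon_sub] at hT
        exact mon_sub_mem_freeSym (k := k) (hA.relabel σ.injective.injOn)
          (hB.relabel σ.injective.injOn) hT
      rw [← h₁.2, h₂.2, e]
      exact hr
  | zero => rw [map_zero]; exact .zero
  | add _ _ h₁ h₂ => rw [map_add]; exact .add h₁ h₂
  | smul x _ h => rw [map_smul]; exact .smul x h
  | relabel φ hφ _ h =>
    rw [forgetPlanar_mapDomain (g' := SMon.relabel φ) fun _ => rfl]
    exact .relabel φ hφ.injOn h
  | @comp_right X Y c d a f S _ hS hS' hm _ hd h =>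
    rw [forgetPlanar_mapDomain (g' := fun T => T.graft a (SMon.mk S)) fun _ => rfl]
    exact .comp_right h hS' hm hd
  | @comp_left X Y c d a T f hT hT' _ hm _ hd h =>
    rw [forgetPlanar_mapDomain (g' := fun S => (SMon.mk T).graft a S) fun _ => rfl]
    exact .comp_left hT' h hm hd

theorem coeffSum_forgetPlanar (f : Mon c →₀ k) :
    coeffSum k _ (forgetPlanar k c f) = coeffSum k _ f :=
  coeffSum_mapDomain _ f

theorem mem_shIdeal_of_coeffSum_eq_zero {X : CSet} {f : Mon c →₀ k} (hf : f ∈ FreeSh k X c)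
    (h : coeffSum k _ f = 0) : f ∈ shIdeal (shRelations k) X c := by
  refine mem_of_coeffSum_eq_zero (fun T hT T' hT' => ?_) hf h
  have := (cong_of_leafSet_eq k hT.1 hT'.1 hT.2.1 hT'.2.1 (hT'.2.2.trans hT.2.2.symm)).mem
  rwa [show T.leafSet = X from hT.2.2] at this

theorem mem_shRelIdeal_iff {X : CSet} {f : Mon c →₀ k} :
    f ∈ shRelIdeal k X c ↔ f ∈ FreeSh k X c ∧ coeffSum k _ f = 0 := by
  refine and_congr_right fun hf => ⟨fun h => ?_, fun h => ?_⟩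
  · rw [← coeffSum_forgetPlanar]
    exact InSymIdeal.coeffSum_eq_zero h
  · exact InShIdeal.forgetPlanar_mem (mem_shIdeal_of_coeffSum_eq_zero hf h)

theorem shIdeal_shRelations (X : CSet) (c : Colour) :
    shIdeal (shRelations k) X c = shRelIdeal k X c := by
  ext f
  refine ⟨fun h => ⟨InShIdeal.mem_freeSh h, InShIdeal.forgetPlanar_mem h⟩, fun h => ?_⟩
  obtain ⟨hf, h⟩ := mem_shRelIdeal_iff.1 h
  exact mem_shIdeal_of_coeffSum_eq_zero hf h

/-- An element of the free symmetric operad vanishes in `ICom` if and only if the sum of its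
coefficients is zero: all tree monomials with the same inputs and output are identified. -/
theorem mem_relIdeal_iff {X : CSet} {f : SMon c →₀ k} (hf : f ∈ FreeSym k X c) :
    f ∈ relIdeal k X c ↔ coeffSum k _ f = 0 := by
  refine ⟨InSymIdeal.coeffSum_eq_zero, mem_of_coeffSum_eq_zero (fun T hT T' hT' => ?_) hf⟩
  obtain ⟨A, rfl⟩ := Quotient.exists_rep T
  obtain ⟨B, rfl⟩ := Quotient.exists_rep T'
  have hA : A.HasLeaves X := hT
  have hB : B.HasLeaves X := hT'
  have hA' := (A.same_toShuffle.hasLeaves_iff X).1 hA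
  have hB' := (B.same_toShuffle.hasLeaves_iff X).1 hB
  have := (cong_of_leafSet_eq k (isShuffle_toShuffle hA.1) (isShuffle_toShuffle hB.1) hA'.1 hB'.1
    (hB'.2.trans hA'.2.symm)).mem.forgetPlanar_mem
  rw [map_sub, forgetPlanar_single, forgetPlanar_single, ← mon_eq_of_same k A.same_toShuffle,
    ← mon_eq_of_same k B.same_toShuffle, show A.toShuffle.leafSet = X from hA'.2] at this
  exact this

/-! ### The quadratic Gröbner basis -/

theorem Mon.PathLexLT.irrefl (T : Mon c) : ¬ T.PathLexLT T := by
  rintro (h | ⟨-, h | ⟨-, h⟩⟩)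
  · exact lt_irrefl _ h
  · exact irrefl_of _ _ h
  · exact irrefl_of _ _ h

theorem Mon.Rule.isLeadingTerm {S S' : Mon c} (h : Rule S S') {g : Mon c →₀ k}
    (hg : g = Finsupp.single S 1 - Finsupp.single S' 1 ∨
      g = Finsupp.single S' 1 - Finsupp.single S 1) : IsLeadingTerm PathLexLT S g := by
  have hne := h.ne
  constructor
  · rcases hg with rfl | rfl <;> simp [hne]
  · intro T hT hTS
    have : T = S' := by
      by_contra hTS'
      rcases hg with rfl | rfl <;> simp [Ne.symm hTS, Ne.symm hTS'] at hT
    exact this ▸ h.pathLexLT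

/-- A normal tree is not the leading term of an element that vanishes in `ICom`. -/
theorem not_normal_of_isLeadingTerm {X : CSet} {f : Mon c →₀ k} (hf : f ∈ shRelIdeal k X c)
    {T : Mon c} (hT : IsLeadingTerm PathLexLT T f) : ¬ T.Normal := by
  intro hN
  obtain ⟨hf, h0⟩ := mem_shRelIdeal_iff.1 hf
  obtain ⟨hs, hd, e⟩ := hf hT.1
  have hsupp : f.support ⊆ {T} := fun T' hT' => by
    obtain ⟨hs', hd', e'⟩ := hf hT'
    rw [Finset.mem_singleton]
    by_contra hne
    rcases hN.eq_or_pathLexLT hs hd hs' hd' (e'.trans e.symm) with h | h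
    · exact hne h
    · exact PathLexLT.irrefl _ (h.trans (hT.2 T' hT' hne))
  rw [Finsupp.support_subset_singleton.1 hsupp, coeffSum_single] at h0
  exact Finsupp.mem_support_iff.1 hT.1 h0

theorem isGroebnerBasis_shRelations :
    IsGroebnerBasis (fun _ => PathLexLT) (shRelations k) (shRelIdeal k) where
  homogeneous _ _ hg := hg.1
  generates := shIdeal_shRelations
  leading X c f hf hf0 := by
    have hX : ∀ T ∈ f.support, T.IsShuffle ∧ T.HasLeaves X := fun T hT => hf.1 hT
    obtain ⟨T, hT, hmax⟩ := exists_max_pathLexLT f.support (Finsupp.support_nonempty_iff.2 hf0)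
      fun T hT => (hX T hT).2
    refine ⟨T, ⟨hT, hmax⟩, ?_⟩
    obtain ⟨d, S, S', h, hST⟩ := (normal_or_exists_divides (hX T hT).1 (hX T hT).2.1).resolve_left
      (not_normal_of_isLeadingTerm hf ⟨hT, hmax⟩)
    rcases h.mem_shRelations k with hg | hg
    · exact ⟨d, _, hg, S, h.isLeadingTerm (.inl rfl), hST⟩
    · exact ⟨d, _, hg, S, h.isLeadingTerm (.inr rfl), hST⟩

theorem isQuadratic_shRelations : IsQuadratic (shRelations k) := by
  classical
  rintro c g ⟨⟨X, hX⟩, n, f, hf, σ, -, e⟩ T hT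
  obtain ⟨A, B, Y, rfl, hA, hB, -⟩ := hf.exists_eq
  -- Distinct shuffle trees are distinct as non-planar trees, so that no terms of `g` cancel.
  have hinj : Set.InjOn SMon.mk {T : Mon c | T.IsShuffle ∧ T.HasLeaves X} := fun U hU V hV h =>
    Same.eq_of_isShuffle (Quotient.exact h) hU.2.1 hU.1 hV.1
  have hne : forgetPlanar k c g (SMon.mk T) ≠ 0 := by
    rw [forgetPlanar, Finsupp.lmapDomain_apply, Finsupp.mapDomain_apply' _ g hX hinj (hX hT)]
    exact Finsupp.mem_support_iff.1 hT
  rw [e, mapDomain_relabel_mon_sub] at hne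
  have hsame : Same (A.relabel σ) T ∨ Same (B.relabel σ) T := by
    by_contra! h
    refine hne ?_
    rw [Finsupp.sub_apply, mon, mon, Finsupp.single_eq_of_ne', Finsupp.single_eq_of_ne', sub_zero]
    exacts [fun h' => h.2 (Quotient.exact h'), fun h' => h.1 (Quotient.exact h')]
  rcases hsame with h | h
  · rw [← h.vertices_eq, vertices_relabel, hA]
  · rw [← h.vertices_eq, vertices_relabel, hB]

end

/-! ### Dimensions -/

section

variable (k : Type*) [Field k] {c : Colour}

open Mon

theorem exists_hasLeaves_alg {X : CSet} (hX : X.Nonempty)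
    (hinj : Set.InjOn Prod.fst (X : Set (ℕ × Colour))) : ∃ T : Mon .alg, T.HasLeaves X := by
  have hone (a : ℕ) (c : Colour) : ∃ T : Mon .alg, T.leaves = [(a, c)] := by
    cases c
    exacts [⟨leaf .alg a, rfl⟩, ⟨i (leaf .idl a), rfl⟩]
  induction hX using Finset.Nonempty.cons_induction with
  | singleton p =>
    obtain ⟨T, hT⟩ := hone p.1 p.2
    exact ⟨T, by simp [labels, hT], by simp [hT]⟩
  | cons p X hp hX ih =>
    obtain ⟨S, hS⟩ := hone p.1 p.2
    obtain ⟨T, hT⟩ := ih (hinj.mono (by simp))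
    refine ⟨α S T, ?_, ?_⟩
    · have : p.1 ∉ T.labels := fun h => by
        obtain ⟨v, hv⟩ := mem_labels.1 h
        have hv' : (p.1, v) ∈ X := hT.2 ▸ List.mem_toFinset.2 hv
        have : (p.1, v) = p := hinj (by simp [hv']) (by simp) rfl
        exact hp (this ▸ hv')
      rw [labels_α, show S.labels = [p.1] by simp [labels, hS]]
      simpa using ⟨this, hT.1⟩
    · change (α S T).leafSet = _
      rw [leafSet_α, show T.leafSet = X from hT.2, Finset.cons_eq_insert, Finset.insert_eq]
      simp [leafSet, hS]

theorem exists_hasLeaves_idl {X : CSet} {a : ℕ} (ha : (a, Colour.idl) ∈ X)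
    (hinj : Set.InjOn Prod.fst (X : Set (ℕ × Colour))) : ∃ T : Mon .idl, T.HasLeaves X := by
  rcases (X.erase (a, .idl)).eq_empty_or_nonempty with h | h
  · refine ⟨leaf .idl a, by simp, ?_⟩
    rw [← Finset.insert_erase ha, h]
    rfl
  · obtain ⟨T, hT⟩ := exists_hasLeaves_alg h (hinj.mono (by simp))
    refine ⟨r (leaf .idl a) T, ?_, ?_⟩
    · have : a ∉ T.labels := fun h => by
        obtain ⟨v, hv⟩ := mem_labels.1 h
        have hv' : (a, v) ∈ X.erase (a, .idl) := hT.2 ▸ List.mem_toFinset.2 hv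
        exact (Finset.mem_erase.1 hv').1 (hinj (Finset.mem_erase.1 hv').2 ha rfl)
      simpa using ⟨this, hT.1⟩
    · change (r (leaf .idl a) T).leafSet = _
      rw [leafSet_r, show T.leafSet = _ from hT.2, leafSet_leaf, ← Finset.insert_eq,
        Finset.insert_erase ha]

/-- A tree whose output has the colour of the ideal has an input of this colour. -/
theorem exists_mem_leaves_idl (T : Mon c) (hc : c = .idl) : ∃ a, (a, Colour.idl) ∈ T.leaves := by
  induction T with
  | leaf c a => exact ⟨a, by simp [leaves, hc]⟩
  | i t | α s t => cases hc
  | l s t _ ih =>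
    obtain ⟨a, ha⟩ := ih rfl
    exact ⟨a, by simp [leaves, ha]⟩
  | r s t ih _ =>
    obtain ⟨a, ha⟩ := ih rfl
    exact ⟨a, by simp [leaves, ha]⟩

theorem finite_and_finrank_operad_of_hasLeaves {X : CSet} {T : Mon c} (hT : T.HasLeaves X) :
    Module.Finite k (Operad k X c) ∧ Module.finrank k (Operad k X c) = 1 := by
  let φ : FreeSym k X c →ₗ[k] k := coeffSum k (SMon c) ∘ₗ (FreeSym k X c).subtype
  have hker : LinearMap.ker φ = (relIdeal k X c).submoduleOf (FreeSym k X c) := by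
    ext f
    exact (mem_relIdeal_iff f.2).symm
  have hφ : Function.Surjective φ := fun x =>
    ⟨⟨Finsupp.single (SMon.mk T) x, Finsupp.single_mem_supported k x hT⟩, coeffSum_single _ x⟩
  let e : Operad k X c ≃ₗ[k] k :=
    (Submodule.quotEquivOfEq _ _ hker.symm).trans (φ.quotKerEquivOfSurjective hφ)
  exact ⟨Module.Finite.equiv e.symm, e.finrank_eq.trans (Module.finrank_self k)⟩

theorem finite_and_finrank_operad_of_not_hasLeaves {X : CSet}
    (h : ∀ T : Mon c, ¬ T.HasLeaves X) :
    Module.Finite k (Operad k X c) ∧ Module.finrank k (Operad k X c) = 0 := by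
  have hbot : FreeSym k X c = ⊥ := by
    have : {T : SMon c | T.HasLeaves X} = ∅ := by
      ext T
      obtain ⟨T, rfl⟩ := Quotient.exists_rep T
      exact iff_of_false (h T) (Set.notMem_empty _)
    rw [FreeSym, this, Finsupp.supported_empty]
  have : Subsingleton (FreeSym k X c) := by
    rw [hbot]
    infer_instance
  have : Subsingleton (Operad k X c) := (Submodule.Quotient.mk_surjective _).subsingleton
  exact ⟨inferInstance, Module.finrank_zero_of_subsingleton⟩

theorem injOn_standard {n : ℕ} (χ : Fin n → Colour) :
    Set.InjOn Prod.fst (CSet.standard χ : Set (ℕ × Colour)) := by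
  rintro p hp q hq h
  simp only [CSet.standard, Finset.coe_image, Finset.coe_univ, Set.image_univ,
    Set.mem_range] at hp hq
  obtain ⟨j, rfl⟩ := hp
  obtain ⟨j', rfl⟩ := hq
  obtain rfl : j = j' := Fin.ext (by simpa using h)
  rfl

theorem weight_apply {n : ℕ} (χ : Fin n → Colour) (c : Colour) :
    weight χ c = (Finset.univ.filter fun j => χ j = c).card := by
  simp [weight, Finsupp.finsetSum_apply, Finsupp.single_apply, Finset.sum_boole]

theorem exists_hasLeaves_standard_iff {n : ℕ} (χ : Fin n → Colour) (c : Colour) :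
    (∃ T : Mon c, T.HasLeaves (CSet.standard χ)) ↔
      match c with
      | .alg => weight χ ≠ 0
      | .idl => weight χ .idl ≠ 0 := by
  cases c with
  | alg =>
    constructor
    · rintro ⟨T, hT⟩ h
      obtain ⟨a, ha⟩ := List.exists_mem_of_ne_nil _ T.leaves_ne_nil
      have : a ∈ CSet.standard χ := hT.2 ▸ List.mem_toFinset.2 ha
      obtain ⟨j, -, rfl⟩ := Finset.mem_image.1 this
      have h := DFunLike.congr_fun h (χ j)
      rw [weight_apply, Finsupp.zero_apply, Finset.card_eq_zero] at h
      exact Finset.notMem_empty j (h ▸ by simp)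
    · intro h
      refine exists_hasLeaves_alg ?_ (injOn_standard χ)
      rw [CSet.standard, Finset.image_nonempty, Finset.univ_nonempty_iff]
      by_contra hn
      rw [not_nonempty_iff] at hn
      exact h (by simp [weight])
  | idl =>
    rw [weight_apply, Finset.card_ne_zero]
    constructor
    · rintro ⟨T, hT⟩
      obtain ⟨a, ha⟩ := exists_mem_leaves_idl T rfl
      have : (a, Colour.idl) ∈ CSet.standard χ := hT.2 ▸ List.mem_toFinset.2 ha
      obtain ⟨j, -, hj⟩ := Finset.mem_image.1 this
      exact ⟨j, by simpa using (Prod.ext_iff.1 hj).2⟩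
    · rintro ⟨j, hj⟩
      refine exists_hasLeaves_idl (a := j + 1) (Finset.mem_image.2 ⟨j, by simp, ?_⟩)
        (injOn_standard χ)
      simpa using hj

end

/-! ### Generating series -/

open MvPowerSeries in
theorem coeff_expSeries_add (w : Colour →₀ ℕ) :
    MvPowerSeries.coeff w (expSeries (X .alg + X .idl)) =
      1 / ((w .alg).factorial * (w .idl).factorial : ℕ) := by
  have hw : ∀ p : ℕ × ℕ, w = Finsupp.single .alg p.1 + Finsupp.single .idl p.2 ↔
      p = (w .alg, w .idl) := by
    rintro ⟨p, q⟩
    constructor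
    · rintro rfl
      simp
    · rintro ⟨⟩
      ext c
      cases c <;> simp
  have hpow (d : ℕ) : MvPowerSeries.coeff w ((X .alg + X .idl : MvPowerSeries Colour ℚ) ^ d) =
      if d = w .alg + w .idl then (d.choose (w .alg) : ℚ) else 0 := by
    classical
    rw [(Commute.all _ _).add_pow', map_sum]
    simp only [map_nsmul, X_pow_eq, monomial_mul_monomial, coeff_monomial, hw, mul_one]
    simp [eq_comm]
  rw [expSeries, PowerSeries.coeff_subst (.of_constantCoeff_zero (by simp)),
    finsum_eq_single _ (w .alg + w .idl) fun d hd => by rw [hpow, if_neg hd, smul_zero],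
    hpow, if_pos rfl, PowerSeries.coeff_exp, Nat.cast_add_choose]
  have := Nat.cast_ne_zero (R := ℚ).2 (Nat.factorial_ne_zero (w .alg + w .idl))
  simp
  field_simp

open MvPowerSeries in
theorem coeff_expSeries_alg (w : Colour →₀ ℕ) :
    MvPowerSeries.coeff w (expSeries (X .alg)) =
      if w .idl = 0 then 1 / ((w .alg).factorial : ℚ) else 0 := by
  have hpow (d : ℕ) : MvPowerSeries.coeff w ((X .alg : MvPowerSeries Colour ℚ) ^ d) =
      if d = w .alg ∧ w .idl = 0 then 1 else 0 := by
    classical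
    rw [coeff_X_pow]
    congr 1
    rw [eq_iff_iff]
    constructor
    · rintro h
      simp [h]
    · rintro ⟨rfl, h⟩
      ext c
      cases c <;> simp [h]
  rw [expSeries, PowerSeries.coeff_subst (.of_constantCoeff_zero (by simp)),
    finsum_eq_single _ (w .alg) fun d hd => by rw [hpow, if_neg fun h => hd h.1, smul_zero],
    hpow, PowerSeries.coeff_exp]
  by_cases h : w .idl = 0 <;> simp [h]

theorem isGeneratingSeries_series (k : Type*) [Field k] :
    IsGeneratingSeries (fun _ χ c => Module.finrank k (Operad k (CSet.standard χ) c)) series := by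
  classical
  intro n χ c
  have hdim : Module.finrank k (Operad k (CSet.standard χ) c) =
      if ∃ T : Mon c, T.HasLeaves (CSet.standard χ) then 1 else 0 := by
    split_ifs with h
    · exact (finite_and_finrank_operad_of_hasLeaves k h.choose_spec).2
    · exact (finite_and_finrank_operad_of_not_hasLeaves k (not_exists.1 h)).2
  simp only [hdim, exists_hasLeaves_standard_iff]
  cases c with
  | alg =>
    rw [series, map_sub, coeff_expSeries_add, MvPowerSeries.coeff_one]
    by_cases h : weight χ = 0 <;> simp [h]
  | idl =>
    rw [series, map_sub, coeff_expSeries_add, coeff_expSeries_alg]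
    by_cases h : weight χ .idl = 0 <;> simp [h]

end ICom

/-- For the path-lexicographic ordering with `α < i < l < r`, the orbits of the defining relations
of `ICom` form a quadratic Gröbner basis of the ideal of relations, all components of `ICom` are
finite-dimensional, and their generating series is `(e^{t₁+t₂} - 1, e^{t₁+t₂} - e^{t₁})`. -/
theorem mainTheorem4 (k : Type*) [Field k] [CharZero k] :
    ICom.IsQuadratic (ICom.shRelations k) ∧
    ICom.IsGroebnerBasis (fun _ => ICom.Mon.PathLexLT) (ICom.shRelations k) (ICom.shRelIdeal k) ∧
    (∀ (n : ℕ) (χ : Fin n → ICom.Colour) (c : ICom.Colour),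
      Module.Finite k (ICom.Operad k (ICom.CSet.standard χ) c)) ∧
    ICom.IsGeneratingSeries
      (fun _ χ c => Module.finrank k (ICom.Operad k (ICom.CSet.standard χ) c)) ICom.series := by
  refine ⟨ICom.isQuadratic_shRelations, ICom.isGroebnerBasis_shRelations, fun n χ c => ?_,
    ICom.isGeneratingSeries_series k⟩
  by_cases h : ∃ T : ICom.Mon c, T.HasLeaves (ICom.CSet.standard χ)
  · exact (ICom.finite_and_finrank_operad_of_hasLeaves k h.choose_spec).1
  · exact (ICom.finite_and_finrank_operad_of_not_hasLeaves k (not_exists.1 h)).1
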